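/- Let $k\ge 0$ be an integer and let $\alpha_0,\dots,\alpha_k\ge 0$ be such that $\mu:=\alpha_0+\dots+\alpha_k+\frac{k-1}{2}>0$. On polynomials in $x_0,\dots,x_k$ consider the Dunkl operators $$\mathcal D_j u(x)=\frac{\partial u(x)}{\partial x_j}+\alpha_j\,\frac{u(x)-u(\sigma_j x)}{x_j},\qquad \Delta_h=\mathcal D_0^2+\dots+\mathcal D_k^2,$$ where $\sigma_j$ changes the sign of $x_j$. A spherical $h$-harmonic of degree $m$ is a homogeneous real polynomial $Y$ of degree $m$ with $\Delta_hY=0$. Let $h(x)=\prod_{j=0}^k|x_j|^{\alpha_j}$, let $dS$ be the surface measure of the unit sphere $\mathbf S^k\subset\mathbb R^{k+1}$ (counting measure if $k=0$), and let $P_m(x,y)$ be the reproducing kernel of the space of spherical $h$-harmonics of degree $m$: for each $x$, $P_m(x,\cdot)$ is a spherical $h$-harmonic of degree $m$, and $$Y(x)=\int_{\mathbf S^k}h(y)^2P_m(x,y)Y(y)\,dS(y)$$ for every spherical $h$-harmonic $Y$ of degree $m$. Let $$\Phi(x,z)=\frac{\Gamma(\mu)}{4\prod_{j=0}^k\Gamma(\alpha_j+\frac12)}\int_{[-1,1]^{k+1}}\Bigl(\|x\|^2-2\sum_{j=0}^k\tau_jx_jz_j+\|z\|^2\Bigr)^{-\mu}\prod_{j=0}^k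 c_{\alpha_j}(1+\tau_j)(1-\tau_j^2)^{\alpha_j-1}\,d\tau,\qquad c_\nu=\frac1{B(\frac12,\nu)},$$ where for each $j$ with $\alpha_j=0$ the factor with index $j$ and the integration over $\tau_j$ are omitted and $\tau_j$ is set to $1$. If $\|x\|<\|z\|$, then $$\Phi(x,z)=\sum_{m=0}^\infty\frac1{2(\mu+m)}\,\|x\|^m\|z\|^{-2\mu-m}\,P_m\Bigl(\frac x{\|x\|},\frac z{\|z\|}\Bigr),$$ with absolute convergence (for $x=0$ only the term $m=0$ is present, in which $P_0$ is constant). For every $q<1$ and every $r>0$ the series converges uniformly on the set of all $(x,z)$ with $\|z\|\ge r$ and $\|x\|/\|z\|\le q$. Moreover, for every $q<1$, the series multiplied by $\|z\|^{2\mu}$ converges uniformly to $\|z\|^{2\mu}\Phi(x,z)$ on the set of all $(x,z)$ with $z\ne0$ and $\|x\|/\|z\|\le q$. -/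

import Mathlib

open MeasureTheory Filter Topology

noncomputable section

namespace Dunkl

/-- Euclidean space `ℝ^{k+1}`, with coordinates indexed by `0, …, k`. -/
abbrev E (k : ℕ) := EuclideanSpace ℝ (Fin (k + 1))

/-- The ring of real polynomials in `x_0, …, x_k`. -/
abbrev Poly (k : ℕ) := MvPolynomial (Fin (k + 1)) ℝ

/-- The value of a polynomial at a point of `ℝ^{k+1}`. -/
def Poly.evalAt {k : ℕ} (p : Poly k) (x : E k) : ℝ := MvPolynomial.eval (fun i => x i) p

/-- `μ = α_0 + ⋯ + α_k + (k - 1) / 2`. -/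
def mu {k : ℕ} (α : Fin (k + 1) → ℝ) : ℝ := ∑ j, α j + ((k : ℝ) - 1) / 2

/-- The weight function `h(x) = |x_0|^{α_0} ⋯ |x_k|^{α_k}`. -/
def weight {k : ℕ} (α : Fin (k + 1) → ℝ) (x : E k) : ℝ := ∏ j, |x j| ^ α j

/-- `p ↦ p ∘ σ_j`, where `σ_j` is the reflection `x_j ↦ -x_j`. -/
def reflect {k : ℕ} (j : Fin (k + 1)) : Poly k →ₐ[ℝ] Poly k :=
  MvPolynomial.aeval fun i => if i = j then -MvPolynomial.X i else MvPolynomial.X i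

/-- `p ↦ (p - p ∘ σ_j) / x_j`; the division is exact, see `X_mul_diffQuot`. -/
def diffQuot {k : ℕ} (j : Fin (k + 1)) (p : Poly k) : Poly k :=
  (p - reflect j p).divMonomial (Finsupp.single j 1)

theorem diffQuot_add {k : ℕ} (j : Fin (k + 1)) (p q : Poly k) :
    diffQuot j (p + q) = diffQuot j p + diffQuot j q := by
  unfold diffQuot
  rw [← MvPolynomial.add_divMonomial, map_add]
  congr 1
  ring

theorem diffQuot_smul {k : ℕ} (j : Fin (k + 1)) (c : ℝ) (p : Poly k) :
    diffQuot j (c • p) = c • diffQuot j p := by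
  unfold diffQuot
  rw [map_smul, ← smul_sub]
  ext s
  simp

theorem X_dvd_sub_reflect {k : ℕ} (j : Fin (k + 1)) (p : Poly k) :
    (MvPolynomial.X j : Poly k) ∣ p - reflect j p := by
  induction p using MvPolynomial.induction_on with
  | C a => simp [reflect]
  | add p q hp hq =>
    rw [map_add, add_sub_add_comm]
    exact dvd_add hp hq
  | mul_X p i hp =>
    have h1 : (MvPolynomial.X j : Poly k) ∣ MvPolynomial.X i - reflect j (MvPolynomial.X i) := by
      by_cases h : i = j
      · subst h
        simp [reflect]
      · simp [reflect, h]
    rw [map_mul]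
    have h2 : p * MvPolynomial.X i - reflect j p * reflect j (MvPolynomial.X i)
        = (p - reflect j p) * MvPolynomial.X i
          + reflect j p * (MvPolynomial.X i - reflect j (MvPolynomial.X i)) := by ring
    rw [h2]
    exact dvd_add (hp.mul_right _) (h1.mul_left _)

theorem X_mul_diffQuot {k : ℕ} (j : Fin (k + 1)) (p : Poly k) :
    MvPolynomial.X j * diffQuot j p = p - reflect j p := by
  obtain ⟨q, hq⟩ := X_dvd_sub_reflect j p
  rw [diffQuot, hq, MvPolynomial.X_mul_divMonomial]

/-- The Dunkl operator `D_j p = ∂p/∂x_j + α_j (p - p ∘ σ_j) / x_j`, acting on polynomials. -/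
def dunklOp {k : ℕ} (α : Fin (k + 1) → ℝ) (j : Fin (k + 1)) : Poly k →ₗ[ℝ] Poly k where
  toFun p := MvPolynomial.pderiv j p + α j • diffQuot j p
  map_add' p q := by
    rw [map_add, diffQuot_add, smul_add]
    abel
  map_smul' c p := by
    rw [Derivation.map_smul, diffQuot_smul, smul_add, smul_comm (α j) c]
    rfl

/-- The Dunkl Laplacian `Δ_h = D_0² + ⋯ + D_k²`. -/
def dunklLaplacian {k : ℕ} (α : Fin (k + 1) → ℝ) : Poly k →ₗ[ℝ] Poly k :=
  ∑ j, dunklOp α j ∘ₗ dunklOp α j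

/-- The space of spherical `h`-harmonics of degree `m`: homogeneous polynomials `Y` of degree `m`
with `Δ_h Y = 0`. -/
def hHarmonics {k : ℕ} (α : Fin (k + 1) → ℝ) (m : ℕ) : Submodule ℝ (Poly k) :=
  MvPolynomial.homogeneousSubmodule (Fin (k + 1)) ℝ m ⊓ LinearMap.ker (dunklLaplacian α)

instance hHarmonics_finite {k : ℕ} (α : Fin (k + 1) → ℝ) (m : ℕ) :
    Module.Finite ℝ (hHarmonics α m) := by
  have : FiniteDimensional ℝ (MvPolynomial.homogeneousSubmodule (Fin (k + 1)) ℝ m) :=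
    Module.Finite.iff_fg.2 (MvPolynomial.homogeneousSubmodule_fg _ _ m)
  exact Submodule.finiteDimensional_inf_left _ _

/-- The surface measure `dS` on the unit sphere `S^k` of `ℝ^{k+1}` (of total mass the surface
area). -/
def surfaceMeasure (k : ℕ) : Measure (Metric.sphere (0 : E k) 1) :=
  (volume : Measure (E k)).toSphere

/-- The inner product `⟨u, v⟩ = ∫_{S^k} h² u v dS`. -/
def sphereInner {k : ℕ} (α : Fin (k + 1) → ℝ) (u v : Poly k) : ℝ :=
  ∫ y, weight α (y : E k) ^ 2 * u.evalAt (y : E k) * v.evalAt (y : E k) ∂surfaceMeasure k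

/-- A basis of the space of spherical `h`-harmonics of degree `m`. -/
def hBasis {k : ℕ} (α : Fin (k + 1) → ℝ) (m : ℕ) :
    Module.Basis (Fin (Module.finrank ℝ (hHarmonics α m))) ℝ (hHarmonics α m) :=
  Module.finBasis ℝ (hHarmonics α m)

/-- The Gram matrix of the chosen basis. -/
def gram {k : ℕ} (α : Fin (k + 1) → ℝ) (m : ℕ) :
    Matrix (Fin (Module.finrank ℝ (hHarmonics α m))) (Fin (Module.finrank ℝ (hHarmonics α m))) ℝ :=
  Matrix.of fun i j => sphereInner α (hBasis α m i : Poly k) (hBasis α m j : Poly k)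

/-- The reproducing kernel `P_m(x, y)` of the space of spherical `h`-harmonics of degree `m`,
written in a basis `b_i` with Gram matrix `G` as `∑_{i,j} b_i(x) (G⁻¹)_{ij} b_j(y)`. That it is
the reproducing kernel (hence does not depend on the basis) is proved in `hKernel_mem` and
`hKernel_reproducing`. -/
def hKernel {k : ℕ} (α : Fin (k + 1) → ℝ) (m : ℕ) (x y : E k) : ℝ :=
  ∑ i, ∑ j, (hBasis α m i : Poly k).evalAt x * (gram α m)⁻¹ i j * (hBasis α m j : Poly k).evalAt y

/-- `c_ν = 1 / B(1/2, ν)`. -/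
def betaConst (ν : ℝ) : ℝ := (ProbabilityTheory.beta (1 / 2) ν)⁻¹

/-- The measure in the variable `τ_j`: it is `c_a (1 + τ) (1 - τ²)^{a - 1} dτ` on `[-1, 1]` if
`a ≠ 0`. For `a = 0` the integration is omitted and `τ` is set to `1`. -/
def tauMeasure (a : ℝ) : Measure ℝ :=
  if a = 0 then Measure.dirac 1
  else (volume.restrict (Set.Icc (-1) 1)).withDensity fun τ =>
    ENNReal.ofReal (betaConst a * (1 + τ) * (1 - τ ^ 2) ^ (a - 1))

/-- `Ψ(x, z, τ) = ‖x‖² - 2 (τ_0 x_0 z_0 + ⋯ + τ_k x_k z_k) + ‖z‖²`. -/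
def Psi {k : ℕ} (x z : E k) (τ : Fin (k + 1) → ℝ) : ℝ :=
  ‖x‖ ^ 2 - 2 * ∑ j, τ j * x j * z j + ‖z‖ ^ 2

/-- The fundamental solution `Φ(x, z)` of the Dunkl Laplacian. -/
def Phi {k : ℕ} (α : Fin (k + 1) → ℝ) (x z : E k) : ℝ :=
  Real.Gamma (mu α) / (4 * ∏ j, Real.Gamma (α j + 1 / 2)) *
    ∫ τ, Psi x z τ ^ (-mu α) ∂Measure.pi fun j => tauMeasure (α j)

/-- The term of degree `m` of the expansion,
`(1 / (2 (μ + m))) ‖x‖^m ‖z‖^{-2μ-m} P_m(x / ‖x‖, z / ‖z‖)`. At `x = 0` the argument `x / ‖x‖`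
reads as `0`; this is immaterial, since `P_0` is constant and `‖x‖^m = 0` for `m ≥ 1`. -/
def seriesTerm {k : ℕ} (α : Fin (k + 1) → ℝ) (x z : E k) (m : ℕ) : ℝ :=
  1 / (2 * (mu α + m)) * ‖x‖ ^ m * ‖z‖ ^ (-2 * mu α - m) * hKernel α m (‖x‖⁻¹ • x) (‖z‖⁻¹ • z)

/-! The kernel is the reproducing kernel. -/

theorem continuous_evalAt {k : ℕ} (p : Poly k) : Continuous (p.evalAt) := by
  unfold Poly.evalAt
  exact (MvPolynomial.continuous_eval p).comp (by fun_prop)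

theorem continuous_weight {k : ℕ} {α : Fin (k + 1) → ℝ} (hα : ∀ j, 0 ≤ α j) :
    Continuous (weight α) := by
  unfold weight
  refine continuous_finsetProd _ fun j _ => ?_
  exact Continuous.rpow_const (by fun_prop) fun x => Or.inr (hα j)

instance surfaceMeasure_finite (k : ℕ) : IsFiniteMeasure (surfaceMeasure k) := by
  unfold surfaceMeasure
  infer_instance

theorem integrable_sphere {k : ℕ} {f : E k → ℝ} (hf : Continuous f) :
    Integrable (fun y : Metric.sphere (0 : E k) 1 => f y) (surfaceMeasure k) := by
  have h : Continuous fun y : Metric.sphere (0 : E k) 1 => f y := by fun_prop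
  exact h.integrable_of_hasCompactSupport (HasCompactSupport.of_compactSpace _)

theorem continuous_inner {k : ℕ} {α : Fin (k + 1) → ℝ} (hα : ∀ j, 0 ≤ α j) (u v : Poly k) :
    Continuous fun y : E k => weight α y ^ 2 * u.evalAt y * v.evalAt y :=
  (((continuous_weight hα).pow 2).mul (continuous_evalAt u)).mul (continuous_evalAt v)

theorem evalAt_smul {k m : ℕ} {p : Poly k} (hp : p.IsHomogeneous m) (r : ℝ) (x : E k) :
    p.evalAt (r • x) = r ^ m * p.evalAt x := by
  unfold Poly.evalAt
  have : (fun i => (r • x) i) = r • (fun i => x i) := by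
    ext i
    simp
  rw [this, MvPolynomial.eval_eq', MvPolynomial.eval_eq', Finset.mul_sum]
  refine Finset.sum_congr rfl fun d hd => ?_
  have hd' : d.degree = m := by
    by_contra h
    exact (MvPolynomial.mem_support_iff.1 hd) (hp.coeff_eq_zero h)
  have h2 : ∏ i, r ^ d i = r ^ m := by
    rw [Finset.prod_pow_eq_pow_sum, ← hd', Finsupp.degree_eq_sum]
  simp only [Pi.smul_apply, smul_eq_mul, mul_pow, Finset.prod_mul_distrib, h2]
  ring

theorem sphereInner_self_eq_zero {k m : ℕ} {α : Fin (k + 1) → ℝ} (hα : ∀ j, 0 ≤ α j)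
    {u : Poly k} (hu : u.IsHomogeneous m) (h : sphereInner α u u = 0) : u = 0 := by
  have hc := continuous_inner hα u u
  have hpos : (surfaceMeasure k).IsOpenPosMeasure := by
    unfold surfaceMeasure
    infer_instance
  have hc' : Continuous fun y : Metric.sphere (0 : E k) 1 =>
      weight α (y : E k) ^ 2 * u.evalAt (y : E k) * u.evalAt (y : E k) :=
    hc.comp continuous_subtype_val
  have hz : ∀ y : Metric.sphere (0 : E k) 1, weight α (y : E k) ^ 2 * u.evalAt y * u.evalAt y = 0 := by
    intro y
    by_contra hy
    refine (hc'.integral_pos_of_hasCompactSupport_nonneg_nonzero (μ := surfaceMeasure k)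
      (x := y) (HasCompactSupport.of_compactSpace _) (fun z => ?_) hy).ne' h
    simp only [Pi.zero_apply]
    rw [mul_assoc]
    exact mul_nonneg (sq_nonneg _) (mul_self_nonneg _)
  have hprod : u * ∏ j, MvPolynomial.X j = 0 := by
    apply MvPolynomial.funext
    intro x
    rw [map_mul, map_prod, map_zero]
    by_cases hx : ∃ j, x j = 0
    · obtain ⟨j, hj⟩ := hx
      rw [Finset.prod_eq_zero (Finset.mem_univ j) (by simpa using hj), mul_zero]
    · push Not at hx
      set w : E k := WithLp.toLp 2 x with hw
      have hw0 : w ≠ 0 := by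
        intro h1
        apply hx 0
        have := congrArg (fun v : E k => v 0) h1
        simpa [hw] using this
      have hn : ‖w‖ ≠ 0 := norm_ne_zero_iff.2 hw0
      have hs : ‖w‖⁻¹ • w ∈ Metric.sphere (0 : E k) 1 := by
        simp [norm_smul, hn]
      have h2 := hz ⟨_, hs⟩
      have h3 : weight α (‖w‖⁻¹ • w) ≠ 0 := by
        unfold weight
        refine Finset.prod_ne_zero_iff.2 fun j _ => ?_
        refine (Real.rpow_pos_of_pos (abs_pos.2 ?_) _).ne'
        exact mul_ne_zero (inv_ne_zero hn) (hx j)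
      have h4 : u.evalAt (‖w‖⁻¹ • w) = 0 := by
        simpa [h3] using h2
      rw [evalAt_smul hu] at h4
      have h5 : u.evalAt w = 0 := by
        simpa [hn] using h4
      have h6 : MvPolynomial.eval x u = 0 := h5
      rw [h6, zero_mul]
  rcases mul_eq_zero.1 hprod with h1 | h1
  · exact h1
  · exact absurd h1 (Finset.prod_ne_zero_iff.2 fun j _ => MvPolynomial.X_ne_zero j)

theorem sphereInner_sum_left {k : ℕ} {ι : Type*} {α : Fin (k + 1) → ℝ} (hα : ∀ j, 0 ≤ α j)
    (s : Finset ι) (a : ι → ℝ) (u : ι → Poly k) (v : Poly k) :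
    sphereInner α (∑ i ∈ s, a i • u i) v = ∑ i ∈ s, a i * sphereInner α (u i) v := by
  unfold sphereInner
  simp_rw [← integral_const_mul]
  rw [← integral_finsetSum]
  · refine integral_congr_ae (ae_of_all _ fun y => ?_)
    simp only [Poly.evalAt, map_sum, MvPolynomial.smul_eval]
    rw [Finset.mul_sum, Finset.sum_mul]
    refine Finset.sum_congr rfl fun i _ => ?_
    ring
  · intro i _
    exact (integrable_sphere (continuous_inner hα (u i) v)).const_mul _

theorem sphereInner_comm {k : ℕ} (α : Fin (k + 1) → ℝ) (u v : Poly k) :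
    sphereInner α u v = sphereInner α v u := by
  unfold sphereInner
  refine integral_congr_ae (ae_of_all _ fun y => ?_)
  ring

theorem gram_det_ne_zero {k : ℕ} {α : Fin (k + 1) → ℝ} (hα : ∀ j, 0 ≤ α j) (m : ℕ) :
    IsUnit (gram α m).det := by
  rw [isUnit_iff_ne_zero]
  intro h
  obtain ⟨v, hv, hv0⟩ := Matrix.exists_mulVec_eq_zero_iff.2 h
  set U : hHarmonics α m := ∑ i, v i • hBasis α m i with hU
  have hUc : (U : Poly k) = ∑ i, v i • (hBasis α m i : Poly k) := by
    simp [hU]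
  have key : sphereInner α (U : Poly k) (U : Poly k) = 0 := by
    have h1 : ∀ i, sphereInner α (hBasis α m i : Poly k) (U : Poly k) = 0 := by
      intro i
      rw [sphereInner_comm, hUc, sphereInner_sum_left hα]
      have := congrFun hv0 i
      simp only [Matrix.mulVec, dotProduct, gram, Matrix.of_apply, Pi.zero_apply] at this
      rw [← this]
      refine Finset.sum_congr rfl fun j _ => ?_
      rw [sphereInner_comm, mul_comm]
    conv_lhs => enter [2]; rw [hUc]
    rw [sphereInner_sum_left hα]
    simp [h1]
  have hU0 : (U : Poly k) = 0 := sphereInner_self_eq_zero hα (m := m) U.2.1 key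
  have hU1 : ∑ i, v i • hBasis α m i = 0 := Subtype.ext hU0
  exact hv (funext (Fintype.linearIndependent_iff.1 (hBasis α m).linearIndependent v hU1))

/-- As a function of `y`, the kernel is a spherical `h`-harmonic of degree `m`. -/
theorem hKernel_mem {k : ℕ} (α : Fin (k + 1) → ℝ) (m : ℕ) (x : E k) :
    ∃ Y ∈ hHarmonics α m, ∀ y, hKernel α m x y = Poly.evalAt Y y := by
  refine ⟨∑ j, (∑ i, (hBasis α m i : Poly k).evalAt x * (gram α m)⁻¹ i j) • (hBasis α m j : Poly k),
    Submodule.sum_mem _ fun j _ => Submodule.smul_mem _ _ (hBasis α m j).2, fun y => ?_⟩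
  unfold hKernel
  rw [Finset.sum_comm]
  simp [Poly.evalAt, MvPolynomial.smul_eval, Finset.sum_mul]

/-- The reproducing property `Y(x) = ∫_{S^k} h(y)² P_m(x, y) Y(y) dS(y)`. -/
theorem hKernel_reproducing {k : ℕ} {α : Fin (k + 1) → ℝ} (hα : ∀ j, 0 ≤ α j) (m : ℕ)
    {Y : Poly k} (hY : Y ∈ hHarmonics α m) (x : E k) :
    Y.evalAt x = ∫ y, weight α (y : E k) ^ 2 * hKernel α m x (y : E k) * Y.evalAt (y : E k)
      ∂surfaceMeasure k := by
  set K : Poly k :=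
    ∑ j, (∑ i, (hBasis α m i : Poly k).evalAt x * (gram α m)⁻¹ i j) • (hBasis α m j : Poly k) with hK
  have hK1 : ∀ y, hKernel α m x y = K.evalAt y := by
    intro y
    unfold hKernel
    rw [Finset.sum_comm]
    simp [hK, Poly.evalAt, MvPolynomial.smul_eval, Finset.sum_mul]
  have hb : ∀ l, sphereInner α (hBasis α m l : Poly k) K = (hBasis α m l : Poly k).evalAt x := by
    intro l
    rw [sphereInner_comm, hK, sphereInner_sum_left hα]
    have h1 : ∀ j, sphereInner α (hBasis α m j : Poly k) (hBasis α m l : Poly k)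
        = gram α m j l := fun j => rfl
    simp_rw [h1, Finset.sum_mul]
    rw [Finset.sum_comm]
    have h2 : ∀ i, ∑ j, (hBasis α m i : Poly k).evalAt x * (gram α m)⁻¹ i j * gram α m j l
        = (hBasis α m i : Poly k).evalAt x * ((gram α m)⁻¹ * gram α m) i l := by
      intro i
      rw [Matrix.mul_apply, Finset.mul_sum]
      exact Finset.sum_congr rfl fun j _ => by ring
    simp_rw [h2, Matrix.nonsing_inv_mul _ (gram_det_ne_zero hα m), Matrix.one_apply]
    simp
  have hYb : Y = ∑ l, (hBasis α m).repr ⟨Y, hY⟩ l • (hBasis α m l : Poly k) := by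
    have := congrArg (hHarmonics α m).subtype ((hBasis α m).sum_repr ⟨Y, hY⟩)
    rw [map_sum] at this
    exact this.symm
  have h3 : sphereInner α Y K = Y.evalAt x := by
    conv_lhs => rw [hYb]
    rw [sphereInner_sum_left hα]
    conv_rhs => rw [hYb]
    simp only [hb]
    simp [Poly.evalAt, MvPolynomial.smul_eval]
  rw [← h3, sphereInner_comm]
  simp only [hK1]
  rfl

end Dunkl

end

noncomputable section

namespace Dunkl

open MvPolynomial

/-! The expansion is the Gegenbauer generating function averaged over `τ`. With `r = ‖x‖/‖z‖` and `t
= ∑ τ_j x_j z_j / (‖x‖ ‖z‖)` one has `Ψ = ‖z‖² (1 - 2rt + r²)`, hence `‖z‖^(2μ) Ψ^(-μ) = ∑ r^m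
C_m^μ(t)` for `r < 1` (`hasSum_gegenbauer`). On `|t| ≤ 1` the bound `|C_m^μ(t)| ≤ C_m^μ(1)` holds
and `∑ C_m^μ(1) q^m` converges for `0 ≤ q < 1`. As the `τ`-measure is a probability measure, this
one majorant gives termwise integration and, by the M-test, both uniform statements.

It remains to identify the `τ`-average of `C_m^μ(t)` with a multiple of `P_m`. Averaging `f(τ_0 y_0,
…, τ_k y_k)` over `τ` is the intertwining operator `V`, with `D_j V = V ∂_j`, because the moments
agree (`integral_pow_tauMeasure`, `integral_evalAt_tauProd`). The average is therefore the value of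
`zonalPoly`, which is `h`-harmonic because its Laplacian telescopes
(`dunklLaplacian_sum_zonalTerm`).

To see that `zonalPoly` reproduces, pair it with an `h`-harmonic `Y` of degree `m`. On the sphere
the powers of `‖y‖²` disappear, so all terms but `V⟨x,·⟩^m` have degree below `m` and are orthogonal
to `Y`. The remaining pairing is computed by passing from the sphere to the weight `h² exp(-‖x‖²)`,
for which the adjoint of `D_j` is `2 x_j - D_j`: moving `m` Dunkl operators onto `Y` leaves a
multiple of `Y(x)` (`sphereInner_zonalPoly`). Positivity of the inner product then forces equality
with the kernel (`hKernel_eq_zonalPoly`). -/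

/-! ### The Dunkl operators on monomials -/

/-- The factor `n + a (1 - (-1)^n)` with `D x^n = dunklFactor a n * x^(n - 1)`. -/
def dunklFactor (a : ℝ) (n : ℕ) : ℝ := n + a * (1 - (-1) ^ n)

theorem dunklFactor_zero (a : ℝ) : dunklFactor a 0 = 0 := by simp [dunklFactor]

theorem dunklFactor_of_even (a : ℝ) {n : ℕ} (hn : Even n) : dunklFactor a n = n := by
  simp [dunklFactor, hn.neg_one_pow]

theorem dunklFactor_of_odd (a : ℝ) {n : ℕ} (hn : Odd n) : dunklFactor a n = n + 2 * a := by
  simp only [dunklFactor, hn.neg_one_pow]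
  ring

theorem dunklFactor_pos {a : ℝ} (ha : 0 ≤ a) {n : ℕ} (hn : 0 < n) : 0 < dunklFactor a n := by
  have hn' : (0 : ℝ) < n := Nat.cast_pos.2 hn
  rcases Nat.even_or_odd n with h | h
  · rwa [dunklFactor_of_even a h]
  · rw [dunklFactor_of_odd a h]
    positivity

theorem reflect_monomial {k : ℕ} (j : Fin (k + 1)) (s : Fin (k + 1) →₀ ℕ) (c : ℝ) :
    reflect j (monomial s c) = monomial s ((-1) ^ s j * c) := by
  rw [reflect, aeval_monomial, monomial_eq, Finsupp.prod_fintype _ _ (by simp),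
    Finsupp.prod_fintype _ _ (by simp), algebraMap_eq, map_mul, mul_right_comm, mul_comm]
  congr 1
  have h : ∀ i, (if i = j then -X i else X i : Poly k) ^ s i
      = (if i = j then C ((-1) ^ s j) else 1) * X i ^ s i := by
    intro i
    by_cases hi : i = j
    · subst hi
      simp [neg_pow (X i : Poly k)]
    · simp [hi]
  simp_rw [h, Finset.prod_mul_distrib]
  simp

theorem coeff_reflect {k : ℕ} (j : Fin (k + 1)) (s : Fin (k + 1) →₀ ℕ) (p : Poly k) :
    coeff s (reflect j p) = (-1) ^ s j * coeff s p := by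
  classical
  induction p using MvPolynomial.induction_on' with
  | monomial u a =>
    rw [reflect_monomial, coeff_monomial, coeff_monomial]
    split_ifs with h
    · rw [h]
    · simp
  | add p q hp hq => rw [map_add, coeff_add, coeff_add, hp, hq, mul_add]

/-- A Dunkl operator is a weighted shift of coefficients, like `pderiv` with `n` replaced by
`dunklFactor`. Commutation and intertwining are read off from this formula. -/
theorem coeff_dunklOp {k : ℕ} (α : Fin (k + 1) → ℝ) (j : Fin (k + 1)) (s : Fin (k + 1) →₀ ℕ)
    (p : Poly k) :
    coeff s (dunklOp α j p)
      = dunklFactor (α j) (s j + 1) * coeff (s + Finsupp.single j 1) p := by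
  classical
  change coeff s (pderiv j p + α j • diffQuot j p) = _
  have h1 : coeff s (pderiv j p) = ((s j : ℝ) + 1) * coeff (s + Finsupp.single j 1) p := by
    rw [coeff_pderiv, mul_comm]
  have h2 : coeff s (diffQuot j p) = (1 - (-1) ^ (s j + 1)) * coeff (s + Finsupp.single j 1) p := by
    rw [diffQuot, coeff_divMonomial, coeff_sub, coeff_reflect, add_comm (Finsupp.single j 1)]
    simp only [Finsupp.add_apply, Finsupp.single_eq_same]
    ring
  rw [coeff_add, coeff_smul, h1, h2, dunklFactor]
  push_cast
  rw [smul_eq_mul]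
  ring

theorem dunklOp_monomial {k : ℕ} (α : Fin (k + 1) → ℝ) (j : Fin (k + 1)) (s : Fin (k + 1) →₀ ℕ)
    (c : ℝ) :
    dunklOp α j (monomial s c)
      = monomial (s - Finsupp.single j 1) (dunklFactor (α j) (s j) * c) := by
  classical
  ext t
  rw [coeff_dunklOp, coeff_monomial, coeff_monomial]
  by_cases h : s = t + Finsupp.single j 1
  · subst h
    simp
  · rw [if_neg h, mul_zero]
    split_ifs with h2
    -- Truncated subtraction can give `s - single j 1 = t` although `s ≠ t + single j 1`, but only
    -- if `s j = 0`, where the factor vanishes.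
    · by_cases h3 : s j = 0
      · rw [h3, dunklFactor_zero, zero_mul]
      · exfalso
        apply h
        rw [← h2]
        ext i
        by_cases hi : j = i
        · subst hi
          simp
          omega
        · simp [hi]
    · rfl

theorem dunklOp_comm {k : ℕ} (α : Fin (k + 1) → ℝ) (i j : Fin (k + 1)) (p : Poly k) :
    dunklOp α i (dunklOp α j p) = dunklOp α j (dunklOp α i p) := by
  ext s
  simp only [coeff_dunklOp]
  by_cases h : i = j
  · rw [h]
  · simp only [Finsupp.add_apply, Finsupp.single_apply, h, Ne.symm h, if_false, add_zero]
    rw [add_right_comm]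
    ring

theorem dunklLaplacian_apply {k : ℕ} (α : Fin (k + 1) → ℝ) (p : Poly k) :
    dunklLaplacian α p = ∑ j, dunklOp α j (dunklOp α j p) := by
  simp [dunklLaplacian]

theorem dunklOp_isHomogeneous {k m : ℕ} (α : Fin (k + 1) → ℝ) (j : Fin (k + 1)) {p : Poly k}
    (hp : p.IsHomogeneous (m + 1)) : (dunklOp α j p).IsHomogeneous m := by
  intro s hs
  rw [coeff_dunklOp] at hs
  have h := hp (right_ne_zero_of_mul hs)
  rw [map_add] at h
  simpa [Finsupp.weight_single] using h

theorem dunklOp_mem_hHarmonics {k m : ℕ} {α : Fin (k + 1) → ℝ} (j : Fin (k + 1)) {Y : Poly k}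
    (hY : Y ∈ hHarmonics α (m + 1)) : dunklOp α j Y ∈ hHarmonics α m := by
  refine ⟨dunklOp_isHomogeneous α j hY.1, ?_⟩
  have h : dunklLaplacian α Y = 0 := hY.2
  rw [SetLike.mem_coe, LinearMap.mem_ker, dunklLaplacian_apply]
  simp_rw [fun i => dunklOp_comm α i j]
  rw [← map_sum, ← dunklLaplacian_apply, h, map_zero]

/-! ### Multiplication by the squared norm -/

/-- The polynomial `‖x‖²`. -/
def normSqPoly (k : ℕ) : Poly k := ∑ j, X j ^ 2

theorem normSqPoly_isHomogeneous (k : ℕ) : (normSqPoly k).IsHomogeneous 2 :=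
  IsHomogeneous.sum _ _ _ fun j _ => by simpa using (isHomogeneous_X ℝ j).pow 2

theorem evalAt_normSqPoly {k : ℕ} (x : E k) : (normSqPoly k).evalAt x = ‖x‖ ^ 2 := by
  simp [normSqPoly, Poly.evalAt, EuclideanSpace.norm_sq_eq]

theorem reflect_normSqPoly {k : ℕ} (j : Fin (k + 1)) :
    reflect j (normSqPoly k) = normSqPoly k := by
  rw [normSqPoly, map_sum]
  refine Finset.sum_congr rfl fun i _ => ?_
  by_cases h : i = j <;> simp [reflect, h]

theorem pderiv_normSqPoly {k : ℕ} (j : Fin (k + 1)) :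
    pderiv j (normSqPoly k) = 2 * X j := by
  rw [normSqPoly, map_sum, Finset.sum_eq_single j]
  · simp [Derivation.leibniz_pow]
  · intro i _ h
    simp [Derivation.leibniz_pow, pderiv_X_of_ne h]
  · simp

theorem dunklOp_mul_of_reflect_eq {k : ℕ} (α : Fin (k + 1) → ℝ) {j : Fin (k + 1)} {r : Poly k}
    (hr : reflect j r = r) (q : Poly k) :
    dunklOp α j (r * q) = r * dunklOp α j q + pderiv j r * q := by
  have h : diffQuot j (r * q) = r * diffQuot j q := by
    apply mul_left_cancel₀ (X_ne_zero j)
    rw [X_mul_diffQuot, map_mul, hr, mul_left_comm, X_mul_diffQuot, mul_sub]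
  change pderiv j (r * q) + α j • diffQuot j (r * q)
    = r * (pderiv j q + α j • diffQuot j q) + pderiv j r * q
  rw [Derivation.leibniz, h, smul_eq_mul, smul_eq_mul, mul_add, mul_smul_comm]
  ring

theorem X_mul_dunklOp {k : ℕ} (α : Fin (k + 1) → ℝ) (j : Fin (k + 1)) (q : Poly k) :
    X j * dunklOp α j q = X j * pderiv j q + α j • (q - reflect j q) := by
  change X j * (pderiv j q + α j • diffQuot j q) = _
  rw [mul_add, mul_smul_comm, X_mul_diffQuot]

/-- In the anticommutator of `D_j` and `x_j` the reflected terms cancel, since `q + σ_j q` meets `q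
- σ_j q`. Only `x_j ∂_j` survives, to which Euler's identity applies after summing over `j`. -/
theorem dunklOp_X_mul_add {k : ℕ} (α : Fin (k + 1) → ℝ) (j : Fin (k + 1)) (q : Poly k) :
    dunklOp α j (X j * q) + X j * dunklOp α j q = (1 + 2 * α j) • q + 2 * (X j * pderiv j q) := by
  have h : diffQuot j (X j * q) = q + reflect j q := by
    apply mul_left_cancel₀ (X_ne_zero j)
    rw [X_mul_diffQuot, map_mul]
    simp [reflect]
    ring
  rw [X_mul_dunklOp]
  change pderiv j (X j * q) + α j • diffQuot j (X j * q) + _ = _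
  rw [h, Derivation.leibniz, pderiv_X_self]
  simp only [smul_eq_mul, smul_eq_C_mul, map_add, map_mul, map_one, map_ofNat]
  ring

theorem dunklLaplacian_normSqPoly_mul {k d : ℕ} (α : Fin (k + 1) → ℝ) {q : Poly k}
    (hq : q.IsHomogeneous d) :
    dunklLaplacian α (normSqPoly k * q)
      = normSqPoly k * dunklLaplacian α q + (4 * (d + mu α + 1)) • q := by
  have h1 : ∀ j, dunklOp α j (dunklOp α j (normSqPoly k * q))
      = normSqPoly k * dunklOp α j (dunklOp α j q)
        + ((2 + 4 * α j) • q + (4 : ℝ) • (X j * pderiv j q)) := by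
    intro j
    have e := dunklOp_X_mul_add α j q
    rw [dunklOp_mul_of_reflect_eq α (reflect_normSqPoly j), map_add,
      dunklOp_mul_of_reflect_eq α (reflect_normSqPoly j), pderiv_normSqPoly,
      show (2 * X j * q : Poly k) = (2 : ℝ) • (X j * q) by
        rw [smul_eq_C_mul, map_ofNat]; ring, map_smul]
    rw [← eq_sub_iff_add_eq] at e
    rw [e]
    simp only [smul_eq_C_mul, map_add, map_mul, map_one, map_ofNat]
    ring
  rw [dunklLaplacian_apply, dunklLaplacian_apply]
  simp_rw [h1]
  rw [Finset.sum_add_distrib, Finset.sum_add_distrib, ← Finset.mul_sum, ← Finset.smul_sum,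
    hq.sum_X_mul_pderiv, ← Finset.sum_smul, ← Nat.cast_smul_eq_nsmul ℝ, smul_smul, ← add_smul]
  -- The scalar is `∑ (2 + 4 α_j) + 4 d`, and `4 μ = 4 ∑ α_j + 2 k - 2`.
  congr 2
  rw [Finset.sum_add_distrib, ← Finset.mul_sum, mu]
  simp
  ring

theorem dunklLaplacian_normSqPoly_pow_mul {k n : ℕ} (α : Fin (k + 1) → ℝ) (l : ℕ) {p : Poly k}
    (hp : p.IsHomogeneous n) :
    dunklLaplacian α (normSqPoly k ^ (l + 1) * p)
      = normSqPoly k ^ (l + 1) * dunklLaplacian α p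
        + (4 * (l + 1) * (l + 1 + n + mu α)) • (normSqPoly k ^ l * p) := by
  induction l with
  | zero =>
    rw [zero_add, pow_one, pow_zero, one_mul, dunklLaplacian_normSqPoly_mul α hp]
    congr 2
    push_cast
    ring
  | succ l ih =>
    have hh : (normSqPoly k ^ (l + 1) * p).IsHomogeneous (2 * (l + 1) + n) :=
      ((normSqPoly_isHomogeneous k).pow (l + 1)).mul hp
    rw [pow_succ' (normSqPoly k) (l + 1), mul_assoc, dunklLaplacian_normSqPoly_mul α hh, ih]
    simp only [smul_eq_C_mul, map_add, map_mul, map_one, map_ofNat, map_natCast]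
    push_cast
    ring

/-! ### The Gaussian functional -/

/-- The moments `∫ x^n |x|^(2a) exp(-x²) dx`, for even `n`; the odd ones vanish. -/
def gaussMoment (a : ℝ) (n : ℕ) : ℝ := if Even n then Real.Gamma (a + (n + 1) / 2) else 0

/-- The functional `p ↦ ∫ p h² exp(-‖x‖²) dx`, defined through the moments. -/
def gaussFunctional {k : ℕ} (α : Fin (k + 1) → ℝ) : Poly k →ₗ[ℝ] ℝ :=
  (basisMonomials (Fin (k + 1)) ℝ).constr ℝ fun s => ∏ j, gaussMoment (α j) (s j)

theorem gaussFunctional_monomial {k : ℕ} (α : Fin (k + 1) → ℝ) (s : Fin (k + 1) →₀ ℕ) (c : ℝ) :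
    gaussFunctional α (monomial s c) = c * ∏ j, gaussMoment (α j) (s j) := by
  have h : monomial s c = c • basisMonomials (Fin (k + 1)) ℝ s := by
    rw [coe_basisMonomials, smul_monomial, smul_eq_mul, mul_one]
  rw [h, map_smul, gaussFunctional, Module.Basis.constr_basis, smul_eq_mul]

theorem gaussFunctional_one {k : ℕ} (α : Fin (k + 1) → ℝ) :
    gaussFunctional α 1 = ∏ j, Real.Gamma (α j + 1 / 2) := by
  rw [← C_1, ← monomial_zero', gaussFunctional_monomial]
  simp [gaussMoment]

theorem gaussMoment_add_two {a : ℝ} (ha : 0 ≤ a) {n : ℕ} (hn : Even n) :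
    2 * gaussMoment a (n + 2) = (2 * a + n + 1) * gaussMoment a n := by
  have hn' : Even (n + 2) := hn.add even_two
  rw [gaussMoment, gaussMoment, if_pos hn, if_pos hn',
    show a + (((n + 2 : ℕ) : ℝ) + 1) / 2 = a + (n + 1) / 2 + 1 by push_cast; ring,
    Real.Gamma_add_one (by positivity)]
  ring

/-- Integration by parts against `|x|^(2a) exp(-x²)` in one variable. For `s + t` even everything
vanishes by parity. For `s + t` odd exactly one exponent is odd, so the two factors add up to `s + t
+ 2a`, and the identity is the functional equation of `Γ`. -/
theorem gaussMoment_adjoint {a : ℝ} (ha : 0 ≤ a) (s t : ℕ) :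
    dunklFactor a s * gaussMoment a (s - 1 + t) + dunklFactor a t * gaussMoment a (s + (t - 1))
      = 2 * gaussMoment a (s + t + 1) := by
  rcases Nat.even_or_odd (s + t) with h | h
  · have h1 : gaussMoment a (s + t + 1) = 0 := if_neg (by simpa [Nat.even_add_one] using h)
    -- The truncated `s - 1` at `s = 0` is harmless, because `dunklFactor a 0 = 0`.
    have h2 : dunklFactor a s * gaussMoment a (s - 1 + t) = 0 := by
      rcases Nat.eq_zero_or_pos s with rfl | hs
      · rw [dunklFactor_zero, zero_mul]
      · rw [gaussMoment, if_neg, mul_zero]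
        rw [Nat.not_even_iff_odd]
        grind
    have h3 : dunklFactor a t * gaussMoment a (s + (t - 1)) = 0 := by
      rcases Nat.eq_zero_or_pos t with rfl | hs
      · rw [dunklFactor_zero, zero_mul]
      · rw [gaussMoment, if_neg, mul_zero]
        rw [Nat.not_even_iff_odd]
        grind
    rw [h1, h2, h3]
    simp
  · obtain ⟨n, hn⟩ : ∃ n, s + t = n + 1 := ⟨s + t - 1, by have := h.pos; omega⟩
    have hne : Even n := by grind
    have h2 : dunklFactor a s * gaussMoment a (s - 1 + t) = dunklFactor a s * gaussMoment a n := by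
      rcases Nat.eq_zero_or_pos s with rfl | hs
      · rw [dunklFactor_zero, zero_mul, zero_mul]
      · rw [show s - 1 + t = n by omega]
    have h3 : dunklFactor a t * gaussMoment a (s + (t - 1)) = dunklFactor a t * gaussMoment a n := by
      rcases Nat.eq_zero_or_pos t with rfl | hs
      · rw [dunklFactor_zero, zero_mul, zero_mul]
      · rw [show s + (t - 1) = n by omega]
    rw [h2, h3, hn, gaussMoment_add_two ha hne, ← add_mul]
    congr 1
    have hn' : (s : ℝ) + t = n + 1 := by exact_mod_cast hn
    rcases Nat.even_or_odd s with hs | hs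
    · rw [dunklFactor_of_even a hs, dunklFactor_of_odd a (by grind)]
      linear_combination hn'
    · rw [dunklFactor_of_odd a hs, dunklFactor_of_even a (by grind)]
      linear_combination hn'

/-- This says that the adjoint of `D_j` for the weight `h² exp(-‖x‖²)` is `2 x_j - D_j`. On
monomials only the factor of index `j` differs, so the one-variable identity suffices. -/
theorem gaussFunctional_X_mul_mul {k : ℕ} {α : Fin (k + 1) → ℝ} (hα : ∀ j, 0 ≤ α j)
    (j : Fin (k + 1)) (p q : Poly k) :
    gaussFunctional α (dunklOp α j p * q) + gaussFunctional α (p * dunklOp α j q)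
      = 2 * gaussFunctional α (X j * (p * q)) := by
  classical
  induction p using MvPolynomial.induction_on' with
  | add p p' hp hp' =>
    simp only [map_add, add_mul, mul_add] at hp hp' ⊢
    linear_combination hp + hp'
  | monomial s c =>
    induction q using MvPolynomial.induction_on' with
    | add q q' hq hq' =>
      simp only [map_add, mul_add] at hq hq' ⊢
      linear_combination hq + hq'
    | monomial t d =>
      rw [dunklOp_monomial, dunklOp_monomial, X, monomial_mul, monomial_mul, monomial_mul,
        monomial_mul, gaussFunctional_monomial, gaussFunctional_monomial, gaussFunctional_monomial]
      have hprod : ∀ u : Fin (k + 1) →₀ ℕ, (∀ i, i ≠ j → u i = s i + t i) →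
          ∏ i, gaussMoment (α i) (u i) = gaussMoment (α j) (u j)
            * ∏ i ∈ Finset.univ.erase j, gaussMoment (α i) (s i + t i) := by
        intro u hu
        rw [← Finset.mul_prod_erase _ _ (Finset.mem_univ j)]
        congr 1
        refine Finset.prod_congr rfl fun i hi => ?_
        rw [hu i (Finset.ne_of_mem_erase hi)]
      rw [hprod, hprod, hprod]
      · have := gaussMoment_adjoint (hα j) (s j) (t j)
        simp only [Finsupp.add_apply, Finsupp.tsub_apply, Finsupp.single_eq_same]
        rw [show 1 + (s j + t j) = s j + t j + 1 by ring]
        linear_combination (c * d * ∏ i ∈ Finset.univ.erase j, gaussMoment (α i) (s i + t i)) * this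
      all_goals
        intro i hi
        simp [Ne.symm hi]

theorem gaussFunctional_reflect {k : ℕ} (α : Fin (k + 1) → ℝ) (j : Fin (k + 1)) (p : Poly k) :
    gaussFunctional α (reflect j p) = gaussFunctional α p := by
  induction p using MvPolynomial.induction_on' with
  | add p q hp hq => rw [map_add, map_add, map_add, hp, hq]
  | monomial s c =>
    rw [reflect_monomial, gaussFunctional_monomial, gaussFunctional_monomial]
    rcases Nat.even_or_odd (s j) with h | h
    · rw [h.neg_one_pow, one_mul]
    · rw [Finset.prod_eq_zero (Finset.mem_univ j)
        (if_neg (Nat.not_even_iff_odd.2 h) : gaussMoment (α j) (s j) = 0), mul_zero, mul_zero]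

/-- Applying the functional to `Δ_h Y = 0` and using adjointness against `1`, the reflection parts
drop out by invariance, and Euler's identity leaves `2 (m + 1)` times the value at `Y`. -/
theorem gaussFunctional_hHarmonic {k m : ℕ} {α : Fin (k + 1) → ℝ} (hα : ∀ j, 0 ≤ α j)
    {Y : Poly k} (hY : Y ∈ hHarmonics α (m + 1)) : gaussFunctional α Y = 0 := by
  have h1 : ∀ j, gaussFunctional α (dunklOp α j (dunklOp α j Y))
      = 2 * gaussFunctional α (X j * pderiv j Y) := by
    intro j
    have h := gaussFunctional_X_mul_mul hα j (dunklOp α j Y) 1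
    have h0 : dunklOp α j (1 : Poly k) = 0 := by
      rw [← C_1, ← monomial_zero', dunklOp_monomial]
      simp [dunklFactor_zero]
    rw [h0, mul_zero, map_zero, add_zero, mul_one, mul_one, X_mul_dunklOp, map_add, map_smul, map_sub,
      gaussFunctional_reflect, sub_self, smul_zero, add_zero] at h
    exact h
  have hd : dunklLaplacian α Y = 0 := hY.2
  have h2 := congrArg (gaussFunctional α) (dunklLaplacian_apply α Y)
  rw [hd, map_zero, map_sum] at h2
  simp_rw [h1] at h2
  have hH : Y.IsHomogeneous (m + 1) := hY.1
  rw [← Finset.mul_sum, ← map_sum, hH.sum_X_mul_pderiv, map_nsmul] at h2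
  rw [nsmul_eq_mul] at h2
  have h3 : (m : ℝ) + 1 ≠ 0 := m.cast_add_one_ne_zero
  simpa [h3] using h2.symm

/-- The product `∏_{i=1}^n dunklFactor a i`, a deformation of `n!`. -/
def dunklFactorial (a : ℝ) (n : ℕ) : ℝ := ∏ i ∈ Finset.range n, dunklFactor a (i + 1)

theorem dunklFactorial_pos {a : ℝ} (ha : 0 ≤ a) (n : ℕ) : 0 < dunklFactorial a n :=
  Finset.prod_pos fun i _ => dunklFactor_pos ha i.succ_pos

theorem dunklFactorial_succ (a : ℝ) (n : ℕ) :
    dunklFactorial a (n + 1) = dunklFactorial a n * dunklFactor a (n + 1) :=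
  Finset.prod_range_succ _ _

/-! ### Pairing polynomials with `h`-harmonics under the Gaussian functional. -/

theorem degree_eq_of_mem_support {k n : ℕ} {p : Poly k} (hp : p.IsHomogeneous n)
    {s : Fin (k + 1) →₀ ℕ} (hs : s ∈ p.support) : s.degree = n := by
  by_contra h
  exact mem_support_iff.1 hs (hp.coeff_eq_zero h)

theorem exists_eq_add_single_of_degree {k n : ℕ} {s : Fin (k + 1) →₀ ℕ} (h : s.degree = n + 1) :
    ∃ t j, s = t + Finsupp.single j 1 ∧ t.degree = n := by
  have hs : s ≠ 0 := by
    rintro rfl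
    simp at h
  obtain ⟨j, hj⟩ := Finsupp.ne_iff.1 hs
  have hle : Finsupp.single j 1 ≤ s := by
    rw [Finsupp.single_le_iff]
    exact Nat.one_le_iff_ne_zero.2 hj
  refine ⟨s - Finsupp.single j 1, j, (tsub_add_cancel_of_le hle).symm, ?_⟩
  have h2 := congrArg Finsupp.degree (tsub_add_cancel_of_le hle)
  rw [map_add, h, Finsupp.degree_single] at h2
  omega

/-- Splitting off a factor `x_j`, adjointness trades `x_j t · Y` for `D_j t · Y` and `t · D_j Y`;
the monomial still has smaller degree than the harmonic in both. The first drops the degree by two,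
hence strong induction; the second changes the harmonic, hence the quantification over `m` and `Y`.
-/
theorem gaussFunctional_monomial_mul_of_degree_lt {k : ℕ} {α : Fin (k + 1) → ℝ}
    (hα : ∀ j, 0 ≤ α j) (n : ℕ) : ∀ (s : Fin (k + 1) →₀ ℕ) (c : ℝ) (m : ℕ) (Y : Poly k),
    s.degree = n → n < m → Y ∈ hHarmonics α m → gaussFunctional α (monomial s c * Y) = 0 := by
  induction n using Nat.strong_induction_on with
  | _ n ih =>
    intro s c m Y hs hm hY
    obtain ⟨m, rfl⟩ : ∃ m', m = m' + 1 := ⟨m - 1, by omega⟩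
    rcases n with _ | n
    · obtain rfl : s = 0 := (Finsupp.degree_eq_zero_iff s).1 hs
      rw [monomial_zero', ← smul_eq_C_mul, map_smul, gaussFunctional_hHarmonic hα hY, smul_zero]
    · obtain ⟨t, j, rfl, ht⟩ := exists_eq_add_single_of_degree hs
      have h := gaussFunctional_X_mul_mul hα j (monomial t c) Y
      rw [ih n (by omega) t c m _ ht (by omega) (dunklOp_mem_hHarmonics j hY), add_zero,
        ← mul_assoc, X, monomial_mul, one_mul, add_comm (Finsupp.single j 1), dunklOp_monomial] at h
      by_cases htj : t j = 0
      · rw [htj, dunklFactor_zero, zero_mul, map_zero, zero_mul, map_zero] at h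
        linarith
      · have hd : (t - Finsupp.single j 1).degree < n := by
          have hle : Finsupp.single j 1 ≤ t := by
            rw [Finsupp.single_le_iff]
            exact Nat.one_le_iff_ne_zero.2 htj
          have h2 := congrArg Finsupp.degree (tsub_add_cancel_of_le hle)
          rw [map_add, ht, Finsupp.degree_single] at h2
          omega
        rw [ih _ (by omega) _ _ (m + 1) Y rfl (by omega) hY] at h
        linarith

/-- In equal degrees the term with `D_j t` vanishes by the preceding lemma, so each variable becomes
a Dunkl operator on `Y` at the cost of a factor `1/2`. After `m` steps `D^s Y` is the constant
`coeff s Y` times the deformed factorials. -/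
theorem gaussFunctional_monomial_mul_of_degree_eq {k : ℕ} {α : Fin (k + 1) → ℝ}
    (hα : ∀ j, 0 ≤ α j) (m : ℕ) : ∀ (s : Fin (k + 1) →₀ ℕ) (c : ℝ) (Y : Poly k),
    s.degree = m → Y ∈ hHarmonics α m →
    2 ^ m * gaussFunctional α (monomial s c * Y)
      = c * (∏ j, dunklFactorial (α j) (s j)) * coeff s Y * gaussFunctional α 1 := by
  induction m with
  | zero =>
    intro s c Y hs hY
    obtain rfl : s = 0 := (Finsupp.degree_eq_zero_iff s).1 hs
    have hH : Y.IsHomogeneous 0 := hY.1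
    have hC : Y = C (coeff 0 Y) := totalDegree_eq_zero_iff_eq_C.1 (Nat.le_zero.1 hH.totalDegree_le)
    have hm : monomial 0 c * Y = (c * coeff 0 Y) • (1 : Poly k) := by
      conv_lhs => rw [hC]
      rw [monomial_zero', smul_eq_C_mul, mul_one, map_mul]
    rw [hm, map_smul]
    simp [dunklFactorial]
  | succ m ih =>
    intro s c Y hs hY
    obtain ⟨t, j, rfl, ht⟩ := exists_eq_add_single_of_degree hs
    have h := gaussFunctional_X_mul_mul hα j (monomial t c) Y
    have h0 : gaussFunctional α (dunklOp α j (monomial t c) * Y) = 0 := by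
      rw [dunklOp_monomial]
      refine gaussFunctional_monomial_mul_of_degree_lt hα _ _ _ (m + 1) Y rfl ?_ hY
      have h2 : (t - Finsupp.single j 1).degree ≤ t.degree :=
        Finsupp.degree_mono tsub_le_self
      omega
    rw [h0, zero_add, ← mul_assoc, X, monomial_mul, one_mul, add_comm (Finsupp.single j 1)] at h
    have h2 := ih t c _ ht (dunklOp_mem_hHarmonics j hY)
    rw [coeff_dunklOp] at h2
    have h3 : ∏ i, dunklFactorial (α i) ((t + Finsupp.single j 1 : Fin (k + 1) →₀ ℕ) i)
        = (∏ i, dunklFactorial (α i) (t i)) * dunklFactor (α j) (t j + 1) := by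
      rw [← Finset.mul_prod_erase _ _ (Finset.mem_univ j),
        ← Finset.mul_prod_erase Finset.univ (fun i => dunklFactorial (α i) (t i))
          (Finset.mem_univ j)]
      have h4 : ∏ i ∈ Finset.univ.erase j, dunklFactorial (α i) ((t + Finsupp.single j 1 : Fin (k + 1) →₀ ℕ) i)
          = ∏ i ∈ Finset.univ.erase j, dunklFactorial (α i) (t i) := by
        refine Finset.prod_congr rfl fun i hi => ?_
        simp [Ne.symm (Finset.ne_of_mem_erase hi)]
      rw [h4]
      simp only [Finsupp.add_apply, Finsupp.single_eq_same, dunklFactorial_succ]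
      ring
    rw [h3, pow_succ, mul_assoc, ← h]
    linear_combination h2

theorem gaussFunctional_mul_of_degree_lt {k n m : ℕ} {α : Fin (k + 1) → ℝ} (hα : ∀ j, 0 ≤ α j)
    {p Y : Poly k} (hp : p.IsHomogeneous n) (hn : n < m) (hY : Y ∈ hHarmonics α m) :
    gaussFunctional α (p * Y) = 0 := by
  rw [p.as_sum, Finset.sum_mul, map_sum]
  refine Finset.sum_eq_zero fun s hs => ?_
  refine gaussFunctional_monomial_mul_of_degree_lt hα n s _ m Y ?_ hn hY
  exact degree_eq_of_mem_support hp hs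

theorem gaussFunctional_mul_of_degree_eq {k m : ℕ} {α : Fin (k + 1) → ℝ} (hα : ∀ j, 0 ≤ α j)
    {p Y : Poly k} (hp : p.IsHomogeneous m) (hY : Y ∈ hHarmonics α m) :
    2 ^ m * gaussFunctional α (p * Y)
      = (∑ s ∈ Y.support, coeff s p * (∏ j, dunklFactorial (α j) (s j)) * coeff s Y)
        * gaussFunctional α 1 := by
  -- The pairing is proved over the support of `p` but stated over that of `Y`, where it will be
  -- compared with the evaluation of `Y`.
  have h1 : ∑ s ∈ Y.support, coeff s p * (∏ j, dunklFactorial (α j) (s j)) * coeff s Y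
      = ∑ s ∈ p.support, coeff s p * (∏ j, dunklFactorial (α j) (s j)) * coeff s Y := by
    classical
    rw [Finset.sum_subset (Finset.subset_union_right (s₁ := p.support) (s₂ := Y.support)),
      ← Finset.sum_subset (Finset.subset_union_left (s₁ := p.support) (s₂ := Y.support))]
    · intro s _ hs
      rw [notMem_support_iff.1 hs]
      ring
    · intro s _ hs
      rw [notMem_support_iff.1 hs]
      ring
  rw [h1]
  conv_lhs => rw [p.as_sum]
  rw [Finset.sum_mul, map_sum, Finset.mul_sum, Finset.sum_mul]
  refine Finset.sum_congr rfl fun s hs => ?_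
  refine gaussFunctional_monomial_mul_of_degree_eq hα m s _ Y ?_ hY
  exact degree_eq_of_mem_support hp hs

/-! ### The intertwining operator -/

/-- The factor by which the intertwining operator multiplies `x^n`. -/
def intertwineFactor (a : ℝ) (n : ℕ) : ℝ := n.factorial / dunklFactorial a n

theorem dunklFactor_mul_intertwineFactor {a : ℝ} (ha : 0 ≤ a) (n : ℕ) :
    dunklFactor a (n + 1) * intertwineFactor a (n + 1) = (n + 1) * intertwineFactor a n := by
  have h1 := (dunklFactorial_pos ha n).ne'
  have h2 := (dunklFactor_pos ha n.succ_pos).ne'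
  rw [Nat.succ_eq_add_one] at h2
  rw [intertwineFactor, intertwineFactor, dunklFactorial_succ, Nat.factorial_succ]
  push_cast
  field_simp

/-- The intertwining operator `V`, with `D_j V = V ∂_j`. -/
def intertwine {k : ℕ} (α : Fin (k + 1) → ℝ) : Poly k →ₗ[ℝ] Poly k :=
  (basisMonomials (Fin (k + 1)) ℝ).constr ℝ fun s =>
    monomial s (∏ j, intertwineFactor (α j) (s j))

theorem intertwine_monomial {k : ℕ} (α : Fin (k + 1) → ℝ) (s : Fin (k + 1) →₀ ℕ) (c : ℝ) :
    intertwine α (monomial s c) = monomial s (c * ∏ j, intertwineFactor (α j) (s j)) := by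
  have h : monomial s c = c • basisMonomials (Fin (k + 1)) ℝ s := by
    rw [coe_basisMonomials, smul_monomial, smul_eq_mul, mul_one]
  rw [h, map_smul, intertwine, Module.Basis.constr_basis, smul_monomial, smul_eq_mul]

theorem coeff_intertwine {k : ℕ} (α : Fin (k + 1) → ℝ) (s : Fin (k + 1) →₀ ℕ) (p : Poly k) :
    coeff s (intertwine α p) = coeff s p * ∏ j, intertwineFactor (α j) (s j) := by
  classical
  induction p using MvPolynomial.induction_on' with
  | add p q hp hq => rw [map_add, coeff_add, coeff_add, hp, hq, add_mul]
  | monomial t c =>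
    rw [intertwine_monomial, coeff_monomial, coeff_monomial]
    split_ifs with h
    · rw [h]
    · rw [zero_mul]

theorem intertwine_isHomogeneous {k n : ℕ} (α : Fin (k + 1) → ℝ) {p : Poly k}
    (hp : p.IsHomogeneous n) : (intertwine α p).IsHomogeneous n := by
  intro s hs
  rw [coeff_intertwine] at hs
  exact hp (left_ne_zero_of_mul hs)

theorem dunklOp_intertwine {k : ℕ} {α : Fin (k + 1) → ℝ} (hα : ∀ j, 0 ≤ α j) (j : Fin (k + 1))
    (p : Poly k) : dunklOp α j (intertwine α p) = intertwine α (pderiv j p) := by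
  ext s
  rw [coeff_dunklOp, coeff_intertwine, coeff_intertwine, coeff_pderiv,
    ← Finset.mul_prod_erase _ _ (Finset.mem_univ j),
    ← Finset.mul_prod_erase Finset.univ (fun i => intertwineFactor (α i) (s i))
      (Finset.mem_univ j)]
  have h4 : ∏ i ∈ Finset.univ.erase j, intertwineFactor (α i) ((s + Finsupp.single j 1 : Fin (k + 1) →₀ ℕ) i)
      = ∏ i ∈ Finset.univ.erase j, intertwineFactor (α i) (s i) := by
    refine Finset.prod_congr rfl fun i hi => ?_
    simp [Ne.symm (Finset.ne_of_mem_erase hi)]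
  have h5 := dunklFactor_mul_intertwineFactor (hα j) (s j)
  rw [h4]
  simp only [Finsupp.add_apply, Finsupp.single_eq_same]
  linear_combination (coeff (s + Finsupp.single j 1) p
    * ∏ i ∈ Finset.univ.erase j, intertwineFactor (α i) (s i)) * h5

/-- The linear form `y ↦ ⟨x, y⟩`. -/
def linearForm {k : ℕ} (x : E k) : Poly k := ∑ i, x i • X i

theorem linearForm_isHomogeneous {k : ℕ} (x : E k) : (linearForm x).IsHomogeneous 1 :=
  IsHomogeneous.sum _ _ _ fun j _ => by
    simpa [smul_eq_C_mul] using (isHomogeneous_C (Fin (k + 1)) (x j)).mul (isHomogeneous_X ℝ j)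

theorem linearForm_pow_isHomogeneous {k : ℕ} (x : E k) (n : ℕ) :
    (linearForm x ^ n).IsHomogeneous n := by
  simpa using (linearForm_isHomogeneous x).pow n

theorem pderiv_linearForm_pow {k : ℕ} (x : E k) (j : Fin (k + 1)) (n : ℕ) :
    pderiv j (linearForm x ^ n) = (n * x j) • linearForm x ^ (n - 1) := by
  have h : pderiv j (linearForm x) = C (x j) := by
    rw [linearForm, map_sum, Finset.sum_eq_single j]
    · simp [smul_eq_C_mul]
    · intro i _ hi
      simp [pderiv_X_of_ne hi]
    · simp
  rw [Derivation.leibniz_pow, h]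
  simp only [smul_eq_C_mul, nsmul_eq_mul, smul_eq_mul, map_mul, map_natCast]
  ring

/-- Intertwining reduces this to the classical Laplacian of `⟨x,·⟩^n`. For `n ≤ 1` the coefficient
is zero, so the truncated exponent `n - 2` does not matter. -/
theorem dunklLaplacian_intertwine_linearForm_pow {k : ℕ} {α : Fin (k + 1) → ℝ}
    (hα : ∀ j, 0 ≤ α j) (x : E k) (n : ℕ) :
    dunklLaplacian α (intertwine α (linearForm x ^ n))
      = (n * (n - 1 : ℕ) * ‖x‖ ^ 2) • intertwine α (linearForm x ^ (n - 2)) := by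
  rw [dunklLaplacian_apply]
  simp_rw [dunklOp_intertwine hα, pderiv_linearForm_pow, Derivation.map_smul,
    pderiv_linearForm_pow, smul_smul, map_smul]
  rw [← Finset.sum_smul, EuclideanSpace.norm_sq_eq, Finset.mul_sum]
  congr 1
  refine Finset.sum_congr rfl fun i _ => ?_
  rw [Real.norm_eq_abs, sq_abs]
  ring

/-- `V` divides by exactly the deformed factorials that the pairing produces. What remains is `∏
s_j!` times the multinomial coefficient, that is `m!`, and the sum becomes `Y(x)`. -/
theorem gaussFunctional_intertwine_linearForm_pow_mul {k m : ℕ} {α : Fin (k + 1) → ℝ}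
    (hα : ∀ j, 0 ≤ α j) {Y : Poly k} (hY : Y ∈ hHarmonics α m) (x : E k) :
    2 ^ m * gaussFunctional α (intertwine α (linearForm x ^ m) * Y)
      = m.factorial * Y.evalAt x * gaussFunctional α 1 := by
  have hH : Y.IsHomogeneous m := hY.1
  rw [gaussFunctional_mul_of_degree_eq hα
    (intertwine_isHomogeneous α (linearForm_pow_isHomogeneous x m)) hY]
  congr 1
  rw [Poly.evalAt, eval_eq', Finset.mul_sum]
  refine Finset.sum_congr rfl fun s hs => ?_
  have hd := degree_eq_of_mem_support hH hs
  rw [Finsupp.degree_eq_sum] at hd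
  have hsum : (s.sum fun _ n => n) = m := by rw [← hd, Finsupp.sum_fintype _ _ (by simp)]
  have hm : ((∏ j, (s j).factorial : ℕ) : ℝ) * s.multinomial = m.factorial := by
    have h := Nat.multinomial_spec Finset.univ s
    rw [hd] at h
    rw [← h, Finsupp.multinomial_of_support_subset (Finset.subset_univ s.support)]
    push_cast
    rfl
  rw [coeff_intertwine, linearForm, coeff_linearCombination_X_pow_of_fintype, if_pos hsum,
    Finsupp.prod_fintype _ _ (by simp), ← hm]
  have h2 : (∏ j, intertwineFactor (α j) (s j)) * ∏ j, dunklFactorial (α j) (s j)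
      = ((∏ j, (s j).factorial : ℕ) : ℝ) := by
    rw [← Finset.prod_mul_distrib]
    push_cast
    refine Finset.prod_congr rfl fun j _ => ?_
    rw [intertwineFactor, div_mul_cancel₀ _ (dunklFactorial_pos (hα j) _).ne']
  rw [← h2]
  ring

/-! ### The zonal polynomials -/

/-- The coefficient of `t^n` in the Gegenbauer polynomial of degree `n + 2 l` with parameter
`c`. -/
def gegenbauerCoeff (c : ℝ) (n l : ℕ) : ℝ :=
  (-1) ^ l * (ascPochhammer ℝ (n + l)).eval c * 2 ^ n / (l.factorial * n.factorial)

/-- The relation that makes neighbouring terms of `Δ_h (zonalPoly α m x)` cancel. -/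
theorem gegenbauerCoeff_recurrence (c : ℝ) (n l : ℕ) :
    4 * (l + 1) * (l + 1 + n + c) * gegenbauerCoeff c n (l + 1)
      = -((n + 2) * (n + 1) * gegenbauerCoeff c (n + 2) l) := by
  have h1 : (l.factorial : ℝ) ≠ 0 := Nat.cast_ne_zero.2 l.factorial_ne_zero
  have h2 : (n.factorial : ℝ) ≠ 0 := Nat.cast_ne_zero.2 n.factorial_ne_zero
  have h3 : (l : ℝ) + 1 ≠ 0 := l.cast_add_one_ne_zero
  have h4 : (n : ℝ) + 1 ≠ 0 := n.cast_add_one_ne_zero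
  have h5 : (n : ℝ) + 2 ≠ 0 := by positivity
  rw [gegenbauerCoeff, gegenbauerCoeff, show n + 2 + l = n + (l + 1) + 1 by ring,
    ascPochhammer_succ_eval, Nat.factorial_succ l, Nat.factorial_succ (n + 1), Nat.factorial_succ n]
  push_cast
  field_simp
  ring

/-- The term of index `l` of the zonal polynomial. -/
def zonalTerm {k : ℕ} (α : Fin (k + 1) → ℝ) (m : ℕ) (x : E k) (l : ℕ) : Poly k :=
  if 2 * l ≤ m then
    (gegenbauerCoeff (mu α) (m - 2 * l) l * ‖x‖ ^ (2 * l)) •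
      (normSqPoly k ^ l * intertwine α (linearForm x ^ (m - 2 * l)))
  else 0

/-- The polynomial `y ↦ ‖x‖^m ‖y‖^m V(C_m(⟨x, ·⟩ / (‖x‖ ‖y‖)))(y)`, where `C_m` is the Gegenbauer
polynomial with parameter `μ` and `V` the intertwining operator. -/
def zonalPoly {k : ℕ} (α : Fin (k + 1) → ℝ) (m : ℕ) (x : E k) : Poly k :=
  ∑ l ∈ Finset.range (m + 1), zonalTerm α m x l

theorem zonalTerm_isHomogeneous {k : ℕ} (α : Fin (k + 1) → ℝ) (m : ℕ) (x : E k) (l : ℕ) :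
    (zonalTerm α m x l).IsHomogeneous m := by
  unfold zonalTerm
  split_ifs with h
  · rw [smul_eq_C_mul]
    have h1 := ((normSqPoly_isHomogeneous k).pow l).mul
      (intertwine_isHomogeneous α (linearForm_pow_isHomogeneous x (m - 2 * l)))
    have h2 := (isHomogeneous_C (Fin (k + 1))
      (gegenbauerCoeff (mu α) (m - 2 * l) l * ‖x‖ ^ (2 * l))).mul h1
    rwa [zero_add, Nat.add_sub_cancel' h] at h2
  · exact isHomogeneous_zero _ _ _

/-- The Laplacian of each term has two parts, one with `‖y‖^(2l)` and one with `‖y‖^(2l-2)`. The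
second cancels the first part of the previous term, so a partial sum leaves only the first part of
its last term. -/
theorem dunklLaplacian_sum_zonalTerm {k : ℕ} {α : Fin (k + 1) → ℝ} (hα : ∀ j, 0 ≤ α j) (m : ℕ)
    (x : E k) (M : ℕ) :
    dunklLaplacian α (∑ l ∈ Finset.range (M + 1), zonalTerm α m x l)
      = if 2 * M + 2 ≤ m then
          (gegenbauerCoeff (mu α) (m - 2 * M) M * ‖x‖ ^ (2 * M)
            * ((m - 2 * M : ℕ) * (m - 2 * M - 1 : ℕ) * ‖x‖ ^ 2)) •
            (normSqPoly k ^ M * intertwine α (linearForm x ^ (m - 2 * M - 2)))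
        else 0 := by
  induction M with
  | zero =>
    rw [zero_add, Finset.sum_range_one, zonalTerm, if_pos (by omega)]
    simp only [mul_zero, Nat.sub_zero, pow_zero, mul_one, one_mul, zero_add, map_smul,
      dunklLaplacian_intertwine_linearForm_pow hα, smul_smul]
    split_ifs with h
    · rfl
    · have : (m : ℝ) * (m - 1 : ℕ) = 0 := by
        have : m = 0 ∨ m - 1 = 0 := by omega
        rcases this with h | h <;> simp [h]
      rw [this, zero_mul, mul_zero, zero_smul]
  | succ M ih =>
    rw [Finset.sum_range_succ, map_add, ih, zonalTerm]
    by_cases h1 : 2 * (M + 1) ≤ m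
    · obtain ⟨n, rfl⟩ : ∃ n, m = n + 2 * (M + 1) := ⟨m - 2 * (M + 1), by omega⟩
      have e1 : n + 2 * (M + 1) - 2 * M = n + 2 := by omega
      have e2 : n + 2 * (M + 1) - 2 * (M + 1) = n := by omega
      rw [if_pos (by omega), if_pos h1, map_smul,
        dunklLaplacian_normSqPoly_pow_mul α M
          (intertwine_isHomogeneous α (linearForm_pow_isHomogeneous x _)),
        dunklLaplacian_intertwine_linearForm_pow hα, e1, e2, Nat.add_sub_cancel,
        show n + 2 - 1 = n + 1 from rfl]
      have hr := gegenbauerCoeff_recurrence (mu α) n M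
      -- The case distinction is superfluous: it fails only for `n ≤ 1`, where `n (n - 1)` vanishes.
      have hB : (if 2 * (M + 1) + 2 ≤ n + 2 * (M + 1) then
          (gegenbauerCoeff (mu α) n (M + 1) * ‖x‖ ^ (2 * (M + 1))
            * ((n : ℕ) * (n - 1 : ℕ) * ‖x‖ ^ 2)) •
            (normSqPoly k ^ (M + 1) * intertwine α (linearForm x ^ (n - 2))) else 0)
          = (gegenbauerCoeff (mu α) n (M + 1) * ‖x‖ ^ (2 * (M + 1))
            * ((n : ℕ) * (n - 1 : ℕ) * ‖x‖ ^ 2)) •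
            (normSqPoly k ^ (M + 1) * intertwine α (linearForm x ^ (n - 2))) := by
        split_ifs with h
        · rfl
        · have h3 : (n : ℝ) * (n - 1 : ℕ) = 0 := by
            have : n = 0 ∨ n - 1 = 0 := by omega
            rcases this with h | h <;> simp [h]
          rw [h3, zero_mul, mul_zero, zero_smul]
      rw [hB, mul_smul_comm, smul_add, smul_smul, smul_smul, add_left_comm, ← add_smul]
      have hz : gegenbauerCoeff (mu α) (n + 2) M * ‖x‖ ^ (2 * M)
            * (((n + 2 : ℕ) : ℝ) * ((n + 1 : ℕ) : ℝ) * ‖x‖ ^ 2)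
          + gegenbauerCoeff (mu α) n (M + 1) * ‖x‖ ^ (2 * (M + 1))
            * (4 * (M + 1) * (M + 1 + n + mu α)) = 0 := by
        push_cast
        linear_combination ‖x‖ ^ (2 * (M + 1)) * hr
      rw [hz, zero_smul, add_zero]
    · rw [if_neg (by omega), if_neg h1, if_neg (by omega), map_zero, add_zero]

theorem zonalPoly_mem_hHarmonics {k : ℕ} {α : Fin (k + 1) → ℝ} (hα : ∀ j, 0 ≤ α j) (m : ℕ)
    (x : E k) : zonalPoly α m x ∈ hHarmonics α m := by
  refine ⟨IsHomogeneous.sum _ _ _ fun l _ => zonalTerm_isHomogeneous α m x l, ?_⟩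
  rw [SetLike.mem_coe, LinearMap.mem_ker, zonalPoly, dunklLaplacian_sum_zonalTerm hα,
    if_neg (by omega)]

/-! ### Integration over the sphere -/

theorem integral_gaussMoment {a : ℝ} (ha : 0 ≤ a) (n : ℕ) :
    ∫ t : ℝ, (|t| ^ a) ^ 2 * t ^ n * Real.exp (-t ^ 2) = gaussMoment a n := by
  rw [gaussMoment]
  split_ifs with hn
  · have h1 : ∀ t : ℝ, (|t| ^ a) ^ 2 * t ^ n * Real.exp (-t ^ 2)
        = (fun r : ℝ => (r ^ a) ^ 2 * r ^ n * Real.exp (-r ^ 2)) |t| := by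
      intro t
      simp only [hn.pow_abs, sq_abs]
    refine (integral_congr_ae (ae_of_all _ h1)).trans ((integral_comp_abs
      (f := fun r : ℝ => (r ^ a) ^ 2 * r ^ n * Real.exp (-r ^ 2))).trans ?_)
    have h2 : ∀ r ∈ Set.Ioi (0 : ℝ), (r ^ a) ^ 2 * r ^ n * Real.exp (-r ^ 2)
        = r ^ (2 * a + n) * Real.exp (-r ^ (2 : ℝ)) := by
      intro r hr
      rw [Real.rpow_add hr, mul_comm 2 a, Real.rpow_mul (le_of_lt hr), Real.rpow_natCast,
        Real.rpow_two, Real.rpow_two]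
    have hq : 0 ≤ 2 * a + n := by positivity
    rw [setIntegral_congr_fun measurableSet_Ioi h2,
      integral_rpow_mul_exp_neg_rpow two_pos (by linarith)]
    rw [← mul_assoc, mul_one_div_cancel two_ne_zero, one_mul]
    congr 1
    ring
  · have hodd : Odd n := Nat.not_even_iff_odd.1 hn
    have h := integral_neg_eq_self (fun t : ℝ => (|t| ^ a) ^ 2 * t ^ n * Real.exp (-t ^ 2)) volume
    simp only [abs_neg, hodd.neg_pow, mul_neg, neg_mul, integral_neg, even_two.neg_pow] at h
    linarith

theorem integral_gaussian_monomial {k : ℕ} {α : Fin (k + 1) → ℝ} (hα : ∀ j, 0 ≤ α j)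
    (s : Fin (k + 1) →₀ ℕ) :
    ∫ x : E k, weight α x ^ 2 * Poly.evalAt (monomial s 1) x * Real.exp (-‖x‖ ^ 2)
      = gaussFunctional α (monomial s 1) := by
  rw [gaussFunctional_monomial, one_mul,
    ← (PiLp.volume_preserving_toLp (Fin (k + 1))).integral_comp
      (MeasurableEquiv.toLp 2 (Fin (k + 1) → ℝ)).measurableEmbedding]
  simp_rw [← fun j => integral_gaussMoment (hα j) (s j)]
  rw [← integral_fintype_prod_volume_eq_prod
    (f := fun j t => (|t| ^ α j) ^ 2 * t ^ s j * Real.exp (-t ^ 2))]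
  refine integral_congr_ae (ae_of_all _ fun x => ?_)
  simp only [weight, Poly.evalAt, eval_monomial, EuclideanSpace.norm_sq_eq, Real.norm_eq_abs,
    sq_abs, one_mul, ← Finset.sum_neg_distrib, Real.exp_sum, Finset.prod_mul_distrib,
    Finset.prod_pow]
  rw [Finsupp.prod_fintype _ _ (by simp)]

/-- Polar coordinates, `dx = r^k dr dS`. No integrability is required, as the integral of a product
function over a product measure always factors. -/
theorem integral_polar_mul (k : ℕ) (f : E k → ℝ) (g : ℝ → ℝ) :
    ∫ x : E k, f (‖x‖⁻¹ • x) * g ‖x‖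
      = (∫ y, f (y : E k) ∂surfaceMeasure k) * ∫ r in Set.Ioi (0 : ℝ), r ^ k * g r := by
  have hdim : Module.finrank ℝ (E k) - 1 = k := by simp
  calc
    ∫ x : E k, f (‖x‖⁻¹ • x) * g ‖x‖
        = ∫ x : ({(0)}ᶜ : Set (E k)), f (‖x.1‖⁻¹ • x.1) * g ‖x.1‖ 
            ∂((volume : Measure (E k)).comap Subtype.val) := by
      rw [integral_subtype_comap (measurableSet_singleton _).compl
        fun x : E k => f (‖x‖⁻¹ • x) * g ‖x‖, restrict_compl_singleton]
    _ = ∫ p, f (p.1 : E k) * g p.2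
          ∂(volume : Measure (E k)).toSphere.prod (.volumeIoiPow (Module.finrank ℝ (E k) - 1)) := by
      simpa using (volume : Measure (E k)).measurePreserving_homeomorphUnitSphereProd.integral_comp
        (Homeomorph.measurableEmbedding _)
        (fun p : Metric.sphere (0 : E k) 1 × Set.Ioi (0 : ℝ) => f (p.1 : E k) * g p.2)
    _ = (∫ y, f (y : E k) ∂surfaceMeasure k)
          * ∫ r : Set.Ioi (0 : ℝ), g r ∂.volumeIoiPow (Module.finrank ℝ (E k) - 1) :=
      integral_prod_mul (fun y : Metric.sphere (0 : E k) 1 => f (y : E k))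
        (fun r : Set.Ioi (0 : ℝ) => g r)
    _ = _ := by
      simp only [Measure.volumeIoiPow, ENNReal.ofReal, hdim]
      rw [integral_withDensity_eq_integral_smul,
        integral_subtype_comap measurableSet_Ioi fun a : ℝ => Real.toNNReal (a ^ k) • g a,
        setIntegral_congr_fun measurableSet_Ioi fun x hx => ?_]
      · rw [NNReal.smul_def, Real.coe_toNNReal _ (pow_nonneg hx.out.le _), smul_eq_mul]
      · exact (measurable_subtype_coe.pow_const _).real_toNNReal

theorem weight_smul {k : ℕ} (α : Fin (k + 1) → ℝ) {r : ℝ} (hr : 0 < r) (x : E k) :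
    weight α (r • x) = r ^ (∑ j, α j) * weight α x := by
  simp only [weight, PiLp.smul_apply, smul_eq_mul, abs_mul, abs_of_pos hr,
    Real.mul_rpow hr.le (abs_nonneg _), Finset.prod_mul_distrib]
  rw [Real.rpow_sum_of_pos hr]

theorem sum_nonneg_of_nonneg {k : ℕ} {α : Fin (k + 1) → ℝ} (hα : ∀ j, 0 ≤ α j) : 0 ≤ ∑ j, α j :=
  Finset.sum_nonneg fun j _ => hα j

/-- `h² p` is homogeneous of degree `2 ∑ α_j + d`, so the radial integral splits off; it equals
`Γ((k + 2 ∑ α_j + d + 1) / 2) / 2`. This transfers the Gaussian identities to the sphere. -/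
theorem integral_gaussian_homogeneous {k d : ℕ} {α : Fin (k + 1) → ℝ} (hα : ∀ j, 0 ≤ α j)
    {p : Poly k} (hp : p.IsHomogeneous d) :
    ∫ x : E k, weight α x ^ 2 * p.evalAt x * Real.exp (-‖x‖ ^ 2)
      = sphereInner α p 1 * (Real.Gamma (d / 2 + mu α + 1) / 2) := by
  have hs := sum_nonneg_of_nonneg hα
  have h1 : ∀ᵐ x : E k, weight α x ^ 2 * p.evalAt x * Real.exp (-‖x‖ ^ 2)
      = (fun y : E k => weight α y ^ 2 * p.evalAt y) (‖x‖⁻¹ • x)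
        * (fun r : ℝ => (r ^ (∑ j, α j)) ^ 2 * r ^ d * Real.exp (-r ^ 2)) ‖x‖ := by
    have h0 : ∀ᵐ x : E k, x ≠ 0 := by simp [ae_iff]
    filter_upwards [h0] with x hx
    have hn : 0 < ‖x‖ := norm_pos_iff.2 hx
    have hx' : x = ‖x‖ • (‖x‖⁻¹ • x) := (smul_inv_smul₀ hn.ne' x).symm
    have hw : weight α x = ‖x‖ ^ (∑ j, α j) * weight α (‖x‖⁻¹ • x) := by
      conv_lhs => rw [hx']
      exact weight_smul α hn _
    have hpx : p.evalAt x = ‖x‖ ^ d * p.evalAt (‖x‖⁻¹ • x) := by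
      conv_lhs => rw [hx']
      exact evalAt_smul hp _ _
    rw [hw, hpx]
    ring
  refine (integral_congr_ae h1).trans ((integral_polar_mul k
    (fun y => weight α y ^ 2 * p.evalAt y)
    (fun r => (r ^ (∑ j, α j)) ^ 2 * r ^ d * Real.exp (-r ^ 2))).trans ?_)
  congr 1
  · simp [sphereInner, Poly.evalAt]
  · have h2 : ∀ r ∈ Set.Ioi (0 : ℝ),
        r ^ k * ((r ^ (∑ j, α j)) ^ 2 * r ^ d * Real.exp (-r ^ 2))
        = r ^ (k + 2 * (∑ j, α j) + d) * Real.exp (-r ^ (2 : ℝ)) := by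
      intro r hr
      rw [Real.rpow_add hr, Real.rpow_add hr, mul_comm 2, Real.rpow_mul (le_of_lt hr),
        Real.rpow_natCast, Real.rpow_natCast, Real.rpow_two, Real.rpow_two]
      ring
    have hq : 0 ≤ k + 2 * (∑ j, α j) + d := by positivity
    rw [setIntegral_congr_fun measurableSet_Ioi h2,
      integral_rpow_mul_exp_neg_rpow two_pos (by linarith), mu, one_div_mul_eq_div]
    congr 2
    ring

theorem sphereInner_one_mul_Gamma {k d : ℕ} {α : Fin (k + 1) → ℝ} (hα : ∀ j, 0 ≤ α j)
    {p : Poly k} (hp : p.IsHomogeneous d) :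
    sphereInner α p 1 * (Real.Gamma (d / 2 + mu α + 1) / 2) = gaussFunctional α p := by
  have hsum : p = ∑ s ∈ p.support, coeff s p • (monomial s 1 : Poly k) := by
    conv_lhs => rw [p.as_sum]
    simp [smul_monomial]
  conv_lhs => rw [hsum]
  conv_rhs => rw [hsum]
  rw [sphereInner_sum_left hα, map_sum, Finset.sum_mul]
  refine Finset.sum_congr rfl fun s hs => ?_
  rw [map_smul, smul_eq_mul, ← integral_gaussian_monomial hα, mul_assoc,
    ← integral_gaussian_homogeneous hα
      (isHomogeneous_monomial (1 : ℝ) (degree_eq_of_mem_support hp hs))]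

theorem sphereInner_eq_mul_one {k : ℕ} (α : Fin (k + 1) → ℝ) (p q : Poly k) :
    sphereInner α p q = sphereInner α (p * q) 1 := by
  simp [sphereInner, Poly.evalAt, mul_assoc]

theorem sphereInner_normSqPoly_pow_mul {k : ℕ} (α : Fin (k + 1) → ℝ) (l : ℕ) (p q : Poly k) :
    sphereInner α (normSqPoly k ^ l * p) q = sphereInner α p q := by
  unfold sphereInner
  refine integral_congr_ae (ae_of_all _ fun y => ?_)
  have h : (normSqPoly k ^ l * p).evalAt (y : E k) = p.evalAt (y : E k) := by
    have h1 := evalAt_normSqPoly (y : E k)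
    rw [norm_eq_of_mem_sphere y, one_pow] at h1
    unfold Poly.evalAt at h1 ⊢
    rw [map_mul, map_pow, h1, one_pow, one_mul]
  simp only [h]

/-- The reproducing property of `zonalPoly`, up to the constant. Only the term `l = 0` contributes.
-/
theorem sphereInner_zonalPoly {k m : ℕ} {α : Fin (k + 1) → ℝ} (hα : ∀ j, 0 ≤ α j)
    (hμ : 0 < mu α) {Y : Poly k} (hY : Y ∈ hHarmonics α m) (x : E k) :
    (m + mu α) * Real.Gamma (mu α) * sphereInner α (zonalPoly α m x) Y
      = 2 * (∏ j, Real.Gamma (α j + 1 / 2)) * Y.evalAt x := by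
  have hH : Y.IsHomogeneous m := hY.1
  have hlow : ∀ l ∈ Finset.range (m + 1), l ≠ 0 → 1 * sphereInner α (zonalTerm α m x l) Y = 0 := by
    intro l _ hl
    rw [one_mul, zonalTerm]
    split_ifs with h
    · have hp : (intertwine α (linearForm x ^ (m - 2 * l))).IsHomogeneous (m - 2 * l) :=
        intertwine_isHomogeneous α (linearForm_pow_isHomogeneous x _)
      -- For `l ≥ 1` the degree `m - 2 l` is below `m`, so the Gaussian functional of the product
      -- vanishes and with it the integral over the sphere.
      have h1 : sphereInner α (intertwine α (linearForm x ^ (m - 2 * l))) Y = 0 := by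
        have h2 := sphereInner_one_mul_Gamma hα (hp.mul hH)
        rw [gaussFunctional_mul_of_degree_lt hα hp (by omega) hY, ← sphereInner_eq_mul_one] at h2
        refine (mul_eq_zero.1 h2).resolve_right (div_pos (Real.Gamma_pos_of_pos ?_) two_pos).ne'
        positivity
      -- Linearity over a single index serves to pull out the scalar.
      have h3 := sphereInner_sum_left hα (Finset.univ : Finset Unit)
        (fun _ => gegenbauerCoeff (mu α) (m - 2 * l) l * ‖x‖ ^ (2 * l))
        (fun _ => normSqPoly k ^ l * intertwine α (linearForm x ^ (m - 2 * l))) Y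
      rw [Fintype.sum_unique, Fintype.sum_unique, sphereInner_normSqPoly_pow_mul, h1,
        mul_zero] at h3
      exact h3
    · simp [sphereInner, Poly.evalAt]
  have hz : zonalPoly α m x = ∑ l ∈ Finset.range (m + 1), (1 : ℝ) • zonalTerm α m x l := by
    simp only [one_smul]
    rfl
  have hp : (intertwine α (linearForm x ^ m)).IsHomogeneous m :=
    intertwine_isHomogeneous α (linearForm_pow_isHomogeneous x _)
  have h0 : sphereInner α (zonalPoly α m x) Y
      = gegenbauerCoeff (mu α) m 0 * sphereInner α (intertwine α (linearForm x ^ m)) Y := by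
    rw [hz, sphereInner_sum_left hα, Finset.sum_eq_single_of_mem 0 (by simp) hlow]
    have h3 := sphereInner_sum_left hα (Finset.univ : Finset Unit)
      (fun _ => gegenbauerCoeff (mu α) m 0)
      (fun _ => intertwine α (linearForm x ^ m)) Y
    rw [Fintype.sum_unique, Fintype.sum_unique] at h3
    rw [← h3, zonalTerm, if_pos (by omega)]
    simp
  have h2 := sphereInner_one_mul_Gamma hα (hp.mul hH)
  rw [← sphereInner_eq_mul_one] at h2
  have h4 := gaussFunctional_intertwine_linearForm_pow_mul hα hY x
  rw [← h2, gaussFunctional_one] at h4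
  -- The Pochhammer symbol split off from `Γ(m + μ + 1)` cancels the one in the leading Gegenbauer
  -- coefficient.
  have h5 : Real.Gamma (((m + m : ℕ) : ℝ) / 2 + mu α + 1)
      = (m + mu α) * ((ascPochhammer ℝ m).eval (mu α) * Real.Gamma (mu α)) := by
    have h6 : ∀ n : ℕ, Real.Gamma (n + mu α) = (ascPochhammer ℝ n).eval (mu α)
        * Real.Gamma (mu α) := by
      intro n
      induction n with
      | zero => simp
      | succ n ih =>
        rw [ascPochhammer_succ_eval, show ((n + 1 : ℕ) : ℝ) + mu α = (n + mu α) + 1 by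
          push_cast; ring, Real.Gamma_add_one (by positivity), ih]
        ring
    rw [← h6, ← Real.Gamma_add_one (by positivity)]
    congr 1
    push_cast
    ring
  rw [h5] at h4
  generalize ∏ j, Real.Gamma (α j + 1 / 2) = G at h4 ⊢
  have hf : (m.factorial : ℝ) ≠ 0 := Nat.cast_ne_zero.2 m.factorial_ne_zero
  rw [h0, gegenbauerCoeff]
  simp only [pow_zero, add_zero, one_mul, Nat.factorial_zero, Nat.cast_one]
  field_simp
  linear_combination 2 * h4

theorem hKernel_eq_zonalPoly {k : ℕ} {α : Fin (k + 1) → ℝ} (hα : ∀ j, 0 ≤ α j)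
    (hμ : 0 < mu α) (m : ℕ) (x y : E k) :
    2 * (∏ j, Real.Gamma (α j + 1 / 2)) * hKernel α m x y
      = (m + mu α) * Real.Gamma (mu α) * (zonalPoly α m x).evalAt y := by
  obtain ⟨K, hK, hKx⟩ := hKernel_mem α m x
  set A : ℝ := 2 * ∏ j, Real.Gamma (α j + 1 / 2) with hA
  set B : ℝ := (m + mu α) * Real.Gamma (mu α) with hB
  have hrep : ∀ Y ∈ hHarmonics α m, sphereInner α K Y = Y.evalAt x := by
    intro Y hY
    rw [hKernel_reproducing hα m hY x]
    simp only [hKx]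
    rfl
  -- Both summands pair with every `h`-harmonic to the same multiple of its value at `x`, with
  -- opposite signs. So `W` is orthogonal to all of them, itself included.
  set W : Poly k := A • K + (-B) • zonalPoly α m x with hW
  have hWm : W ∈ hHarmonics α m :=
    Submodule.add_mem _ (Submodule.smul_mem _ _ hK)
      (Submodule.smul_mem _ _ (zonalPoly_mem_hHarmonics hα m x))
  have hW0 : sphereInner α W W = 0 := by
    have h3 := sphereInner_sum_left hα (Finset.univ : Finset (Fin 2)) ![A, -B]
      ![K, zonalPoly α m x] W
    simp only [Fin.sum_univ_two, Matrix.cons_val_zero, Matrix.cons_val_one] at h3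
    have h4 := sphereInner_zonalPoly hα hμ hWm x
    rw [← hW, hrep W hWm] at h3
    rw [h3]
    linear_combination -h4
  have hz : W = 0 := sphereInner_self_eq_zero hα (m := m) hWm.1 hW0
  have he := congrArg (fun p : Poly k => p.evalAt y) hz
  rw [hKx]
  simp only [hW, Poly.evalAt, map_add, smul_eval, map_zero] at he
  unfold Poly.evalAt
  linear_combination he

/-! ### The moments of the measures in the variables `τ_j` -/

theorem integral_betaPDFReal {a : ℝ} (ha : 0 < a) :
    Integrable (ProbabilityTheory.betaPDFReal a a) ∧
      ∫ x, ProbabilityTheory.betaPDFReal a a x = 1 := by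
  have h0 : ∀ x, 0 ≤ ProbabilityTheory.betaPDFReal a a x := by
    intro x
    by_cases hx : 0 < x ∧ x < 1
    · exact (ProbabilityTheory.betaPDFReal_pos hx.1 hx.2 ha ha).le
    · rw [ProbabilityTheory.betaPDFReal, if_neg hx]
  have h1 := ProbabilityTheory.lintegral_betaPDF_eq_one ha ha
  have hm : AEStronglyMeasurable (ProbabilityTheory.betaPDFReal a a) volume :=
    (ProbabilityTheory.stronglyMeasurable_betaPDFReal a a).aestronglyMeasurable
  constructor
  · refine ⟨hm, ?_⟩
    rw [hasFiniteIntegral_iff_ofReal (ae_of_all _ h0)]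
    exact lt_of_eq_of_lt h1 ENNReal.one_lt_top
  · rw [integral_eq_lintegral_of_nonneg_ae (ae_of_all _ h0) hm]
    exact (congrArg ENNReal.toReal h1).trans ENNReal.toReal_one

/-- The substitution `u = (τ + 1) / 2` gives `1 - τ² = 4 u (1 - u)`, which turns the weight into a
symmetric beta density. -/
theorem betaPDFReal_affine {a : ℝ} (ha : 0 < a) (τ : ℝ) :
    (Set.Ioo (-1 : ℝ) 1).indicator (fun τ => (1 - τ ^ 2) ^ (a - 1)) τ
      = ProbabilityTheory.beta a a * 4 ^ (a - 1)
        * ProbabilityTheory.betaPDFReal a a (1 / 2 * (τ + 1)) := by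
  have hb := (ProbabilityTheory.beta_pos ha ha).ne'
  by_cases hτ : τ ∈ Set.Ioo (-1 : ℝ) 1
  · have h1 : 0 < 1 / 2 * (τ + 1) := by linarith [hτ.1]
    have h2 : 1 / 2 * (τ + 1) < 1 := by linarith [hτ.2]
    rw [Set.indicator_of_mem hτ, ProbabilityTheory.betaPDFReal, if_pos ⟨h1, h2⟩, mul_assoc (1 / _),
      ← Real.mul_rpow h1.le (by linarith),
      show 1 - τ ^ 2 = 4 * (1 / 2 * (τ + 1) * (1 - 1 / 2 * (τ + 1))) by ring,
      Real.mul_rpow (by norm_num) (mul_nonneg h1.le (by linarith))]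
    field_simp
  · rw [Set.indicator_of_notMem hτ, ProbabilityTheory.betaPDFReal, if_neg, mul_zero]
    rintro ⟨h1, h2⟩
    exact hτ ⟨by linarith, by linarith⟩

/-- Legendre's duplication formula. -/
theorem beta_self_mul {a : ℝ} (ha : 0 < a) :
    ProbabilityTheory.beta a a * 4 ^ (a - 1) * 2 = ProbabilityTheory.beta (1 / 2) a := by
  have h := Real.Gamma_mul_Gamma_add_half a
  have h1 := (Real.Gamma_pos_of_pos ha).ne'
  have h2 : Real.Gamma (2 * a) ≠ 0 := (Real.Gamma_pos_of_pos (by linarith)).ne'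
  have h3 : Real.Gamma (a + 1 / 2) ≠ 0 := (Real.Gamma_pos_of_pos (by linarith)).ne'
  have h4 : (4 : ℝ) ^ (a - 1) * 2 * 2 ^ (1 - 2 * a) = 1 := by
    have h5 : (4 : ℝ) ^ (a - 1) = 2 ^ (2 * (a - 1)) := by
      rw [Real.rpow_mul two_pos.le]
      norm_num
    rw [h5, ← Real.rpow_add_one two_ne_zero, ← Real.rpow_add two_pos,
      show 2 * (a - 1) + 1 + (1 - 2 * a) = 0 by ring, Real.rpow_zero]
  rw [ProbabilityTheory.beta, ProbabilityTheory.beta, Real.Gamma_one_half_eq, ← two_mul,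
    add_comm (1 / 2) a, eq_div_iff h3, mul_assoc, mul_assoc, div_mul_eq_mul_div, div_eq_iff h2]
  linear_combination (4 ^ (a - 1) * 2 * Real.Gamma a) * h
    + (Real.Gamma a * √Real.pi * Real.Gamma (2 * a)) * h4

theorem intervalIntegrable_one_sub_sq_rpow {a : ℝ} (ha : 0 < a) :
    IntervalIntegrable (fun τ : ℝ => (1 - τ ^ 2) ^ (a - 1)) volume (-1) 1 := by
  rw [intervalIntegrable_iff_integrableOn_Ioo_of_le (by norm_num),
    ← integrable_indicator_iff measurableSet_Ioo]
  have h := (((integral_betaPDFReal ha).1.comp_mul_left' (R := 1 / 2) (by norm_num)).comp_add_right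
    1).const_mul (ProbabilityTheory.beta a a * 4 ^ (a - 1))
  exact h.congr (ae_of_all _ fun τ => (betaPDFReal_affine ha τ).symm)

theorem integral_one_sub_sq_rpow {a : ℝ} (ha : 0 < a) :
    ∫ τ in (-1 : ℝ)..1, (1 - τ ^ 2) ^ (a - 1) = ProbabilityTheory.beta (1 / 2) a := by
  rw [intervalIntegral.integral_of_le (by norm_num), integral_Ioc_eq_integral_Ioo,
    ← integral_indicator measurableSet_Ioo]
  simp_rw [betaPDFReal_affine ha]
  rw [integral_const_mul,
    integral_add_right_eq_self (fun τ => ProbabilityTheory.betaPDFReal a a (1 / 2 * τ)),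
    Measure.integral_comp_mul_left, (integral_betaPDFReal ha).2, ← beta_self_mul ha]
  norm_num

theorem intervalIntegrable_pow_mul_one_sub_sq {a : ℝ} (ha : 0 < a) (n : ℕ) :
    IntervalIntegrable (fun τ : ℝ => τ ^ n * (1 - τ ^ 2) ^ (a - 1)) volume (-1) 1 :=
  (intervalIntegrable_one_sub_sq_rpow ha).continuousOn_mul (by fun_prop)

theorem integral_pow_mul_one_sub_sq_of_odd (a : ℝ) {n : ℕ} (hn : Odd n) :
    ∫ τ in (-1 : ℝ)..1, τ ^ n * (1 - τ ^ 2) ^ (a - 1) = 0 := by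
  have h := intervalIntegral.integral_comp_neg (a := -1) (b := 1)
    (fun τ : ℝ => τ ^ n * (1 - τ ^ 2) ^ (a - 1))
  simp only [hn.neg_pow, neg_mul, even_two.neg_pow, intervalIntegral.integral_neg, neg_neg] at h
  linarith

/-- Integrate the derivative of `τ^(n+1) (1 - τ²)^a`, which vanishes at `±1`. For `a < 1` the
derivative is singular at the endpoints, so differentiability is used only in the open interval. -/
theorem integral_pow_add_two_mul_one_sub_sq {a : ℝ} (ha : 0 < a) (n : ℕ) :
    (n + 1 + 2 * a) * ∫ τ in (-1 : ℝ)..1, τ ^ (n + 2) * (1 - τ ^ 2) ^ (a - 1)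
      = (n + 1) * ∫ τ in (-1 : ℝ)..1, τ ^ n * (1 - τ ^ 2) ^ (a - 1) := by
  have hi := fun n => intervalIntegrable_pow_mul_one_sub_sq ha n
  have h := intervalIntegral.integral_eq_sub_of_hasDerivAt_of_le (a := (-1 : ℝ)) (b := 1)
    (f := fun τ => τ ^ (n + 1) * (1 - τ ^ 2) ^ a)
    (f' := fun τ => (n + 1) * (τ ^ n * (1 - τ ^ 2) ^ (a - 1))
      - (n + 1 + 2 * a) * (τ ^ (n + 2) * (1 - τ ^ 2) ^ (a - 1)))
    (by norm_num) ?_ ?_ (((hi n).const_mul _).sub ((hi (n + 2)).const_mul _))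
  · rw [intervalIntegral.integral_sub ((hi n).const_mul _) ((hi (n + 2)).const_mul _),
      intervalIntegral.integral_const_mul, intervalIntegral.integral_const_mul] at h
    norm_num [Real.zero_rpow ha.ne'] at h
    linarith
  · exact (Continuous.mul (by fun_prop)
      (Continuous.rpow_const (by fun_prop) fun _ => Or.inr ha.le)).continuousOn
  · intro τ hτ
    have hpos : 0 < 1 - τ ^ 2 := by nlinarith [hτ.1, hτ.2]
    have h1 : HasDerivAt (fun τ : ℝ => τ ^ (n + 1)) ((n + 1) * τ ^ n) τ := by
      simpa using hasDerivAt_pow (n + 1) τ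
    have h2 : HasDerivAt (fun τ : ℝ => (1 - τ ^ 2) ^ a)
        (-(2 * τ) * a * (1 - τ ^ 2) ^ (a - 1)) τ := by
      have h3 : HasDerivAt (fun τ : ℝ => 1 - τ ^ 2) (-(2 * τ)) τ := by
        simpa using (hasDerivAt_pow 2 τ).const_sub 1
      exact h3.rpow_const (Or.inl hpos.ne')
    refine (h1.mul h2).congr_deriv ?_
    have h4 : (1 - τ ^ 2) ^ a = (1 - τ ^ 2) * (1 - τ ^ 2) ^ (a - 1) := by
      nth_rewrite 2 [← Real.rpow_one (1 - τ ^ 2)]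
      rw [← Real.rpow_add hpos]
      ring_nf
    rw [h4]
    ring

theorem betaConst_pos {a : ℝ} (ha : 0 < a) : 0 < betaConst a :=
  inv_pos.2 (ProbabilityTheory.beta_pos (by norm_num) ha)

theorem tauDensity_nonneg {a : ℝ} (ha : 0 < a) {τ : ℝ} (hτ : τ ∈ Set.Icc (-1 : ℝ) 1) :
    0 ≤ betaConst a * (1 + τ) * (1 - τ ^ 2) ^ (a - 1) := by
  have h1 : 0 ≤ 1 + τ := by linarith [hτ.1]
  have h2 : 0 ≤ 1 - τ ^ 2 := by nlinarith [hτ.1, hτ.2]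
  have := (betaConst_pos ha).le
  positivity

theorem measurable_tauDensity (a : ℝ) :
    Measurable fun τ : ℝ => betaConst a * (1 + τ) * (1 - τ ^ 2) ^ (a - 1) := by
  fun_prop

theorem integral_tauMeasure {a : ℝ} (ha : 0 < a) (f : ℝ → ℝ) :
    ∫ τ, f τ ∂tauMeasure a
      = ∫ τ in (-1 : ℝ)..1, betaConst a * (1 + τ) * (1 - τ ^ 2) ^ (a - 1) * f τ := by
  rw [tauMeasure, if_neg ha.ne', integral_withDensity_eq_integral_toReal_smul₀
    (measurable_tauDensity a).ennreal_ofReal.aemeasurable (ae_of_all _ fun _ => ENNReal.ofReal_lt_top),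
    intervalIntegral.integral_of_le (by norm_num), ← integral_Icc_eq_integral_Ioc]
  refine setIntegral_congr_fun measurableSet_Icc fun τ hτ => ?_
  simp only [smul_eq_mul]
  rw [ENNReal.toReal_ofReal (tauDensity_nonneg ha hτ)]

theorem integral_pow_tauMeasure_eq {a : ℝ} (ha : 0 < a) (n : ℕ) :
    ∫ τ, τ ^ n ∂tauMeasure a
      = betaConst a * ((∫ τ in (-1 : ℝ)..1, τ ^ n * (1 - τ ^ 2) ^ (a - 1))
        + ∫ τ in (-1 : ℝ)..1, τ ^ (n + 1) * (1 - τ ^ 2) ^ (a - 1)) := by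
  rw [integral_tauMeasure ha, ← intervalIntegral.integral_add
    (intervalIntegrable_pow_mul_one_sub_sq ha n) (intervalIntegrable_pow_mul_one_sub_sq ha (n + 1)),
    ← intervalIntegral.integral_const_mul]
  congr 1
  ext τ
  ring

/-- Owing to the factor `1 + τ`, the moment of odd order `n` equals that of order `n + 1`, as only
even powers contribute. The step from even to odd order is the integration by parts. These are the
two cases of `dunklFactor`. -/
theorem integral_pow_tauMeasure {a : ℝ} (ha : 0 ≤ a) (n : ℕ) :
    ∫ τ, τ ^ n ∂tauMeasure a = intertwineFactor a n := by
  have key : ∀ v : ℕ → ℝ, v 0 = 1 →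
      (∀ n, dunklFactor a (n + 1) * v (n + 1) = (n + 1) * v n) → v n = intertwineFactor a n := by
    intro v h0 hs
    induction n with
    | zero => simp [h0, intertwineFactor, dunklFactorial]
    | succ n ih =>
      apply mul_left_cancel₀ (dunklFactor_pos ha n.succ_pos).ne'
      rw [Nat.succ_eq_add_one, hs, dunklFactor_mul_intertwineFactor ha, ih]
  rcases ha.eq_or_lt with rfl | ha
  · apply key (fun n => ∫ τ, τ ^ n ∂tauMeasure 0)
    · simp [tauMeasure]
    · simp [tauMeasure, dunklFactor]
  · have hb : ProbabilityTheory.beta (1 / 2) a ≠ 0 :=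
      (ProbabilityTheory.beta_pos (by norm_num) ha).ne'
    apply key (fun n => ∫ τ, τ ^ n ∂tauMeasure a)
    · rw [integral_pow_tauMeasure_eq ha 0, zero_add, integral_pow_mul_one_sub_sq_of_odd a odd_one]
      simp only [pow_zero, one_mul, add_zero, integral_one_sub_sq_rpow ha, betaConst]
      exact inv_mul_cancel₀ hb
    · intro n
      simp only [integral_pow_tauMeasure_eq ha]
      rcases Nat.even_or_odd n with h | h
      · have h1 : Odd (n + 1) := h.add_one
        rw [dunklFactor_of_odd a h1, integral_pow_mul_one_sub_sq_of_odd a h1]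
        have h2 := integral_pow_add_two_mul_one_sub_sq ha n
        push_cast
        rw [show n + 1 + 1 = n + 2 from rfl]
        linear_combination betaConst a * h2
      · have h1 : Even (n + 1) := h.add_one
        rw [dunklFactor_of_even a h1, integral_pow_mul_one_sub_sq_of_odd a h,
          integral_pow_mul_one_sub_sq_of_odd a (h1.add_one)]
        push_cast
        ring

theorem ae_tauMeasure_abs_le (a : ℝ) : ∀ᵐ τ ∂tauMeasure a, |τ| ≤ 1 := by
  unfold tauMeasure
  split_ifs with h
  · simp [ae_dirac_eq]
  · refine (withDensity_absolutelyContinuous _ _).ae_le ?_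
    filter_upwards [ae_restrict_mem measurableSet_Icc] with τ hτ
    exact abs_le.2 hτ

instance tauMeasure_sigmaFinite {a : ℝ} : SigmaFinite (tauMeasure a) := by
  unfold tauMeasure
  split_ifs with h
  · infer_instance
  · exact SigmaFinite.withDensity_ofReal _

theorem tauMeasure_isProbabilityMeasure {a : ℝ} (ha : 0 ≤ a) :
    IsProbabilityMeasure (tauMeasure a) := by
  have h := integral_pow_tauMeasure ha 0
  simp only [pow_zero, integral_const, smul_eq_mul, mul_one] at h
  rw [intertwineFactor] at h
  simp only [dunklFactorial, Finset.range_zero, Finset.prod_empty, Nat.factorial_zero,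
    Nat.cast_one, div_one] at h
  refine ⟨?_⟩
  rw [measureReal_def] at h
  -- An infinite total mass is excluded, since its `toReal` would be `0`.
  exact (ENNReal.toReal_eq_one_iff _).1 h

/-- The product of the measures in the variables `τ_0, …, τ_k`. -/
abbrev tauProd {k : ℕ} (α : Fin (k + 1) → ℝ) : Measure (Fin (k + 1) → ℝ) :=
  Measure.pi fun j => tauMeasure (α j)

theorem ae_tauProd_abs_le {k : ℕ} (α : Fin (k + 1) → ℝ) :
    ∀ᵐ τ ∂tauProd α, ∀ j, |τ j| ≤ 1 := by
  rw [ae_all_iff]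
  intro j
  exact (Measure.tendsto_eval_ae_ae (μ := fun j => tauMeasure (α j)) (i := j)).eventually
    (ae_tauMeasure_abs_le (α j))

/-- The integral representation of `V`. On a monomial the integral factors into the moments of the
variables `τ_j`. -/
theorem integral_evalAt_tauProd {k : ℕ} {α : Fin (k + 1) → ℝ} (hα : ∀ j, 0 ≤ α j) (p : Poly k)
    (y : E k) :
    Integrable (fun τ => eval (fun j => τ j * y j) p) (tauProd α) ∧
      ∫ τ, eval (fun j => τ j * y j) p ∂tauProd α = (intertwine α p).evalAt y := by
  have hprob := fun j => tauMeasure_isProbabilityMeasure (hα j)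
  induction p using MvPolynomial.induction_on' with
  | add p q hp hq =>
    simp only [map_add]
    refine ⟨hp.1.add hq.1, ?_⟩
    rw [integral_add hp.1 hq.1, hp.2, hq.2]
    simp [Poly.evalAt]
  | monomial s c =>
    have h1 : ∀ τ : Fin (k + 1) → ℝ, eval (fun j => τ j * y j) (monomial s c)
        = (c * ∏ j, y j ^ s j) * ∏ j, τ j ^ s j := by
      intro τ
      rw [eval_monomial, Finsupp.prod_fintype _ _ (by simp), mul_assoc, ← Finset.prod_mul_distrib]
      simp_rw [mul_pow, mul_comm]
    simp_rw [h1]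
    constructor
    · refine Integrable.const_mul ?_ _
      refine Integrable.fintype_prod_dep (f := fun j (t : ℝ) => t ^ s j) fun j => ?_
      refine Integrable.mono' (integrable_const (1 : ℝ)) (by fun_prop) ?_
      filter_upwards [ae_tauMeasure_abs_le (α j)] with t ht
      rw [norm_pow]
      exact pow_le_one₀ (norm_nonneg _) ht
    · rw [integral_const_mul, integral_fintype_prod_eq_prod (f := fun j (t : ℝ) => t ^ s j)]
      simp_rw [integral_pow_tauMeasure (hα _)]
      rw [intertwine_monomial, Poly.evalAt, eval_monomial, Finsupp.prod_fintype _ _ (by simp)]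
      ring

/-! ### Gegenbauer polynomials and their generating function -/

/-- The term of index `l` of the Gegenbauer polynomial of degree `m`. -/
def gegenbauerTerm (c t : ℝ) (m l : ℕ) : ℝ :=
  if 2 * l ≤ m then gegenbauerCoeff c (m - 2 * l) l * t ^ (m - 2 * l) else 0

/-- The Gegenbauer polynomial `C_m^c(t)`. -/
def gegenbauer (c t : ℝ) (m : ℕ) : ℝ := ∑ l ∈ Finset.range (m + 1), gegenbauerTerm c t m l

theorem gegenbauerTerm_of_lt (c t : ℝ) {m l : ℕ} (h : m < 2 * l) : gegenbauerTerm c t m l = 0 :=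
  if_neg (by omega)

theorem gegenbauerTerm_zero_recurrence (c t : ℝ) (m : ℕ) :
    (m + 2) * gegenbauerTerm c t (m + 2) 0
      = 2 * (m + 1 + c) * t * gegenbauerTerm c t (m + 1) 0 := by
  have h1 : ((m + 1).factorial : ℝ) ≠ 0 := Nat.cast_ne_zero.2 (m + 1).factorial_ne_zero
  have h2 : (m : ℝ) + 2 ≠ 0 := by positivity
  simp only [gegenbauerTerm, mul_zero, zero_le, if_true, Nat.sub_zero, gegenbauerCoeff, add_zero,
    pow_zero, Nat.factorial_zero, Nat.cast_one, one_mul]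
  rw [show m + 2 = m + 1 + 1 from rfl, ascPochhammer_succ_eval (m + 1), Nat.factorial_succ (m + 1)]
  push_cast
  rw [show (m : ℝ) + 1 + 1 = m + 2 by ring]
  field_simp
  ring

theorem gegenbauerTerm_succ_recurrence (c t : ℝ) (m l : ℕ) :
    (m + 2) * gegenbauerTerm c t (m + 2) (l + 1)
      = 2 * (m + 1 + c) * t * gegenbauerTerm c t (m + 1) (l + 1)
        - (m + 2 * c) * gegenbauerTerm c t m l := by
  have hl : (l.factorial : ℝ) ≠ 0 := Nat.cast_ne_zero.2 l.factorial_ne_zero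
  have hl1 : (l : ℝ) + 1 ≠ 0 := l.cast_add_one_ne_zero
  rcases lt_trichotomy m (2 * l) with h | h | h
  · rw [gegenbauerTerm_of_lt _ _ h, gegenbauerTerm_of_lt _ _ (by omega),
      gegenbauerTerm_of_lt _ _ (by omega)]
    ring
  · subst h
    rw [gegenbauerTerm_of_lt _ _ (show 2 * l + 1 < 2 * (l + 1) by omega), gegenbauerTerm,
      gegenbauerTerm, if_pos (by omega), if_pos le_rfl, Nat.sub_self,
      show 2 * l + 2 - 2 * (l + 1) = 0 by omega]
    simp only [gegenbauerCoeff, zero_add, ascPochhammer_succ_eval l, Nat.factorial_succ l, pow_zero,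
      Nat.factorial_zero]
    push_cast
    field_simp
    ring
  · obtain ⟨n, rfl⟩ : ∃ n, m = n + 1 + 2 * l := ⟨m - 1 - 2 * l, by omega⟩
    have hn : (n.factorial : ℝ) ≠ 0 := Nat.cast_ne_zero.2 n.factorial_ne_zero
    have hn1 : (n : ℝ) + 1 ≠ 0 := n.cast_add_one_ne_zero
    rw [gegenbauerTerm, gegenbauerTerm, gegenbauerTerm, if_pos (by omega), if_pos (by omega),
      if_pos (by omega), show n + 1 + 2 * l + 2 - 2 * (l + 1) = n + 1 by omega,
      show n + 1 + 2 * l + 1 - 2 * (l + 1) = n by omega,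
      show n + 1 + 2 * l - 2 * l = n + 1 by omega]
    simp only [gegenbauerCoeff]
    rw [show n + 1 + (l + 1) = n + l + 1 + 1 by ring, show n + (l + 1) = n + l + 1 by ring,
      show n + 1 + l = n + l + 1 by ring, ascPochhammer_succ_eval (n + l + 1),
      Nat.factorial_succ l, Nat.factorial_succ n]
    push_cast
    field_simp
    ring

theorem gegenbauer_recurrence (c t : ℝ) (m : ℕ) :
    (m + 2) * gegenbauer c t (m + 2)
      = 2 * (m + 1 + c) * t * gegenbauer c t (m + 1) - (m + 2 * c) * gegenbauer c t m := by
  -- The ranges are lengthened by zero terms so that the recurrence can be summed with `l` shifted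
  -- by one.
  have h1 : gegenbauer c t (m + 1) = ∑ l ∈ Finset.range (m + 3), gegenbauerTerm c t (m + 1) l := by
    rw [Finset.sum_range_succ _ (m + 2), gegenbauerTerm_of_lt c t (by omega), add_zero]
    rfl
  have h2 : gegenbauer c t m = ∑ l ∈ Finset.range (m + 2), gegenbauerTerm c t m l := by
    rw [Finset.sum_range_succ _ (m + 1), gegenbauerTerm_of_lt c t (by omega), add_zero]
    rfl
  have h3 : gegenbauer c t (m + 2) = _ := Finset.sum_range_succ' _ (m + 2)
  rw [Finset.sum_range_succ' _ (m + 2)] at h1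
  have h4 := Finset.sum_congr (rfl : Finset.range (m + 2) = _)
    fun l _ => gegenbauerTerm_succ_recurrence c t m l
  rw [Finset.sum_sub_distrib, ← Finset.mul_sum, ← Finset.mul_sum, ← Finset.mul_sum] at h4
  rw [h1, h2, h3]
  linear_combination h4 + gegenbauerTerm_zero_recurrence c t m

/-! ### The generating function as a product of two binomial series. -/

/-- The coefficients of the binomial series of `(1 - w)^(-c)`. -/
def binomCoeff (c : ℝ) (n : ℕ) : ℝ := (ascPochhammer ℝ n).eval c / n.factorial

theorem binomCoeff_nonneg {c : ℝ} (hc : 0 < c) (n : ℕ) : 0 ≤ binomCoeff c n :=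
  div_nonneg (ascPochhammer_pos n c hc).le (Nat.cast_nonneg _)

theorem binomCoeff_succ (c : ℝ) (n : ℕ) :
    (n + 1) * binomCoeff c (n + 1) = (n + c) * binomCoeff c n := by
  have h1 : (n.factorial : ℝ) ≠ 0 := Nat.cast_ne_zero.2 n.factorial_ne_zero
  have h2 : (n : ℝ) + 1 ≠ 0 := n.cast_add_one_ne_zero
  rw [binomCoeff, binomCoeff, ascPochhammer_succ_eval, Nat.factorial_succ]
  push_cast
  field_simp
  ring

theorem ring_choose_eq_binomCoeff (c : ℝ) (n : ℕ) :
    Ring.choose ((c : ℂ) + n - 1) n = (binomCoeff c n : ℂ) := by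
  have h1 : (n.factorial : ℂ) ≠ 0 := Nat.cast_ne_zero.2 n.factorial_ne_zero
  have h2 := Ring.factorial_nsmul_multichoose_eq_ascPochhammer (c : ℂ) n
  rw [Ring.choose, show (c : ℂ) + n - 1 - n + 1 = c by ring]
  apply mul_left_cancel₀ h1
  rw [← nsmul_eq_mul, h2, binomCoeff]
  push_cast
  rw [mul_div_cancel₀ _ h1, Polynomial.ascPochhammer_smeval_eq_eval]
  clear h2
  induction n with
  | zero => simp
  | succ n ih =>
    rw [ascPochhammer_succ_eval, ascPochhammer_succ_eval,
      ih (Nat.cast_ne_zero.2 n.factorial_ne_zero)]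
    push_cast
    rfl

theorem hasSum_binomCoeff (c : ℝ) {w : ℂ} (hw : ‖w‖ < 1) :
    HasSum (fun n => (binomCoeff c n : ℂ) * w ^ n) ((1 - w) ^ (-c : ℂ)) := by
  have h := (Complex.one_div_one_sub_cpow_hasFPowerSeriesOnBall_zero (c : ℂ)).hasSum (y := w)
    (by simpa [enorm_eq_nnnorm, ← NNReal.coe_lt_coe] using hw)
  simp only [zero_add, FormalMultilinearSeries.ofScalars_apply_eq, smul_eq_mul,
    ring_choose_eq_binomCoeff] at h
  rwa [one_div, ← Complex.cpow_neg] at h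

theorem summable_norm_binomCoeff (c : ℝ) {w : ℂ} (hw : ‖w‖ < 1) :
    Summable fun n => ‖(binomCoeff c n : ℂ) * w ^ n‖ :=
  (hasSum_binomCoeff c hw).summable.norm

/-- The value of the Gegenbauer polynomial of degree `m` at `t = 1`. -/
def gegenbauerBound (c : ℝ) (m : ℕ) : ℝ :=
  ∑ p ∈ Finset.HasAntidiagonal.antidiagonal m, binomCoeff c p.1 * binomCoeff c p.2

theorem gegenbauerBound_nonneg {c : ℝ} (hc : 0 < c) (m : ℕ) : 0 ≤ gegenbauerBound c m :=
  Finset.sum_nonneg fun _ _ => mul_nonneg (binomCoeff_nonneg hc _) (binomCoeff_nonneg hc _)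

/-- The coefficients of `(1 - w X)^(-c) (1 - w' X)^(-c)`. -/
def mixedCoeff (c : ℝ) (w w' : ℂ) (m : ℕ) : ℂ :=
  ∑ p ∈ Finset.HasAntidiagonal.antidiagonal m,
    ((binomCoeff c p.1 : ℂ) * w ^ p.1) * ((binomCoeff c p.2 : ℂ) * w' ^ p.2)

theorem mixedCoeff_mul_pow (c : ℝ) (w w' r : ℂ) (m : ℕ) :
    mixedCoeff c (r * w) (r * w') m = r ^ m * mixedCoeff c w w' m := by
  rw [mixedCoeff, mixedCoeff, Finset.mul_sum]
  refine Finset.sum_congr rfl fun p hp => ?_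
  rw [← Finset.HasAntidiagonal.mem_antidiagonal.1 hp, pow_add]
  ring

theorem hasSum_mixedCoeff (c : ℝ) {w w' : ℂ} (hw : ‖w‖ < 1) (hw' : ‖w'‖ < 1) :
    HasSum (mixedCoeff c w w') ((1 - w) ^ (-c : ℂ) * (1 - w') ^ (-c : ℂ)) := by
  have h := summable_norm_sum_mul_antidiagonal_of_summable_norm (summable_norm_binomCoeff c hw)
    (summable_norm_binomCoeff c hw')
  have h2 := tsum_mul_tsum_eq_tsum_sum_antidiagonal_of_summable_norm (summable_norm_binomCoeff c hw)
    (summable_norm_binomCoeff c hw')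
  rw [(hasSum_binomCoeff c hw).tsum_eq, (hasSum_binomCoeff c hw').tsum_eq] at h2
  rw [h2]
  exact h.of_norm.hasSum

/-- The case `w = w' = q` of the product series, with sum `(1 - q)^(-2c)`. -/
theorem summable_gegenbauerBound (c : ℝ) {q : ℝ} (hq : |q| < 1) :
    Summable fun m => gegenbauerBound c m * q ^ m := by
  have hq' : ‖(q : ℂ)‖ < 1 := by simpa using hq
  have h := (hasSum_mixedCoeff c hq' hq').summable
  have h2 : ∀ m, mixedCoeff c q q m = ((gegenbauerBound c m * q ^ m : ℝ) : ℂ) := by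
    intro m
    have := mixedCoeff_mul_pow c 1 1 q m
    rw [mul_one] at this
    rw [this, mixedCoeff, gegenbauerBound]
    push_cast
    simp only [one_pow, mul_one]
    ring
  rw [funext h2] at h
  exact Complex.summable_ofReal.1 h

theorem norm_mixedCoeff_le {c : ℝ} (hc : 0 < c) {w w' : ℂ} (hw : ‖w‖ = 1) (hw' : ‖w'‖ = 1)
    (m : ℕ) : ‖mixedCoeff c w w' m‖ ≤ gegenbauerBound c m := by
  refine norm_sum_le_of_le _ fun p _ => ?_
  rw [norm_mul, norm_mul, norm_mul, norm_pow, norm_pow, hw, hw', one_pow, one_pow, mul_one, mul_one,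
    Complex.norm_real, Complex.norm_real, Real.norm_of_nonneg (binomCoeff_nonneg hc _),
    Real.norm_of_nonneg (binomCoeff_nonneg hc _)]

/-- For `w w' = 1` the power series `F = (1 - wX)^(-c) (1 - w'X)^(-c)` satisfies `(1 - (w + w') X +
X²) F' = (c (w + w') - 2cX) F`. The recurrence is the coefficient of `X^(m+1)`. -/
theorem mixedCoeff_recurrence (c : ℝ) {w w' : ℂ} (h : w * w' = 1) (m : ℕ) :
    (m + 2) * mixedCoeff c w w' (m + 2)
      = (m + 1 + c) * (w + w') * mixedCoeff c w w' (m + 1)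
        - (m + 2 * c) * mixedCoeff c w w' m := by
  let A : ℂ → PowerSeries ℂ := fun w => PowerSeries.mk fun n => (binomCoeff c n : ℂ) * w ^ n
  have hd : ∀ w, (1 - PowerSeries.C w * PowerSeries.X) * PowerSeries.derivative ℂ (A w)
      = PowerSeries.C (c * w) * A w := by
    intro w
    ext n
    have hb : ∀ n : ℕ, ((n : ℂ) + 1) * (binomCoeff c (n + 1) : ℂ)
        = (n + c) * (binomCoeff c n : ℂ) := by
      intro n
      exact_mod_cast binomCoeff_succ c n
    rw [sub_mul, one_mul, map_sub, mul_assoc, PowerSeries.coeff_C_mul, PowerSeries.coeff_C_mul,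
      PowerSeries.coeff_derivative, PowerSeries.coeff_mk, PowerSeries.coeff_mk]
    have hbn := hb n
    rcases n with _ | n
    · rw [PowerSeries.coeff_zero_X_mul]
      push_cast at hbn ⊢
      linear_combination w * hbn
    · rw [PowerSeries.coeff_succ_X_mul, PowerSeries.coeff_derivative, PowerSeries.coeff_mk]
      push_cast at hbn ⊢
      linear_combination w ^ (n + 2) * hbn
  set F : PowerSeries ℂ := A w * A w' with hF
  have hcoeff : ∀ m, PowerSeries.coeff m F = mixedCoeff c w w' m := by
    intro m
    rw [hF, PowerSeries.coeff_mul, mixedCoeff]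
    simp only [A, PowerSeries.coeff_mk]
  have hdF : PowerSeries.derivative ℂ F - PowerSeries.C (w + w') * (PowerSeries.X *
      PowerSeries.derivative ℂ F) + PowerSeries.X * (PowerSeries.X * PowerSeries.derivative ℂ F)
      = PowerSeries.C (c * (w + w')) * F - PowerSeries.C (2 * (c : ℂ)) * (PowerSeries.X * F) := by
    have h1 := hd w
    have h2 := hd w'
    have h3 : PowerSeries.C w * PowerSeries.C w' = (1 : PowerSeries ℂ) := by
      rw [← map_mul, h, map_one]
    have hl : PowerSeries.derivative ℂ F
        = A w * PowerSeries.derivative ℂ (A w') + A w' * PowerSeries.derivative ℂ (A w) := by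
      rw [hF, Derivation.leibniz, smul_eq_mul, smul_eq_mul]
    rw [hl, hF]
    simp only [map_add, map_mul, map_ofNat] at h1 h2 ⊢
    linear_combination (1 - PowerSeries.C w' * PowerSeries.X) * A w' * h1
      + (1 - PowerSeries.C w * PowerSeries.X) * A w * h2
      + (- (PowerSeries.X * PowerSeries.X * (A w * PowerSeries.derivative ℂ (A w')
        + A w' * PowerSeries.derivative ℂ (A w)))
        - 2 * PowerSeries.C (c : ℂ) * PowerSeries.X * A w * A w') * h3
  have hm := congrArg (PowerSeries.coeff (m + 1)) hdF
  rw [map_add, map_sub, map_sub, PowerSeries.coeff_C_mul, PowerSeries.coeff_C_mul,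
    PowerSeries.coeff_C_mul, PowerSeries.coeff_succ_X_mul, PowerSeries.coeff_succ_X_mul,
    PowerSeries.coeff_succ_X_mul, PowerSeries.coeff_derivative, PowerSeries.coeff_derivative,
    hcoeff, hcoeff, hcoeff] at hm
  have hx : PowerSeries.coeff m (PowerSeries.X * PowerSeries.derivative ℂ F)
      = m * mixedCoeff c w w' m := by
    rcases m with _ | m
    · simp
    · rw [PowerSeries.coeff_succ_X_mul, PowerSeries.coeff_derivative, hcoeff, mul_comm]
      push_cast
      ring
  rw [hx] at hm
  push_cast at hm
  linear_combination hm

theorem mixedCoeff_eq_gegenbauer (c t : ℝ) {w w' : ℂ} (h : w * w' = 1) (ht : w + w' = 2 * t)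
    (m : ℕ) : mixedCoeff c w w' m = gegenbauer c t m := by
  induction m using Nat.twoStepInduction with
  | zero =>
    simp [mixedCoeff, gegenbauer, gegenbauerTerm, gegenbauerCoeff, binomCoeff]
  | one =>
    simp [mixedCoeff, gegenbauer, gegenbauerTerm, gegenbauerCoeff, binomCoeff,
      Finset.sum_range_succ,  Finset.Nat.antidiagonal_succ]
    linear_combination (c : ℂ) * ht
  | more m ih1 ih2 =>
    have h1 := mixedCoeff_recurrence c h m
    have h2 : ((m : ℂ) + 2) * gegenbauer c t (m + 2)
        = 2 * (m + 1 + c) * t * gegenbauer c t (m + 1) - (m + 2 * c) * gegenbauer c t m := by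
      exact_mod_cast gegenbauer_recurrence c t m
    have h3 : (m : ℂ) + 2 ≠ 0 := by exact_mod_cast (by omega : m + 2 ≠ 0)
    apply mul_left_cancel₀ h3
    rw [h1, h2, ih1, ih2, ht]
    ring

theorem exists_unit_complex {t : ℝ} (ht : |t| ≤ 1) :
    ∃ w : ℂ, w.re = t ∧ ‖w‖ = 1 := by
  have h : 0 ≤ 1 - t ^ 2 := by
    have := (sq_le_one_iff_abs_le_one t).2 ht
    linarith
  refine ⟨⟨t, √(1 - t ^ 2)⟩, rfl, ?_⟩
  rw [← sq_eq_sq₀ (norm_nonneg _) zero_le_one, ← Complex.normSq_eq_norm_sq, Complex.normSq_mk,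
    Real.mul_self_sqrt h]
  ring

theorem mul_conj_of_norm_eq_one {w : ℂ} (hw : ‖w‖ = 1) : w * (starRingEnd ℂ) w = 1 := by
  rw [Complex.mul_conj, Complex.normSq_eq_norm_sq, hw]
  simp

theorem add_conj_eq_two_mul {w : ℂ} {t : ℝ} (hw : w.re = t) :
    w + (starRingEnd ℂ) w = 2 * t := by
  rw [Complex.add_conj, hw]
  push_cast
  rfl

/-- With `t = Re w`, `|w| = 1`, the polynomial is a sum of unimodular numbers with nonnegative
coefficients. -/
theorem abs_gegenbauer_le {c t : ℝ} (hc : 0 < c) (ht : |t| ≤ 1) (m : ℕ) :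
    |gegenbauer c t m| ≤ gegenbauerBound c m := by
  obtain ⟨w, hw, hn⟩ := exists_unit_complex ht
  have h := norm_mixedCoeff_le hc hn ((RCLike.norm_conj w).trans hn) m
  rwa [mixedCoeff_eq_gegenbauer c t (mul_conj_of_norm_eq_one hn) (add_conj_eq_two_mul hw),
    Complex.norm_real, Real.norm_eq_abs] at h

theorem hasSum_gegenbauer (c : ℝ) {t r : ℝ} (ht : |t| ≤ 1) (hr : |r| < 1) :
    HasSum (fun m => r ^ m * gegenbauer c t m) ((1 - 2 * r * t + r ^ 2) ^ (-c)) := by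
  obtain ⟨w, hw, hn⟩ := exists_unit_complex ht
  have hn' : ‖(starRingEnd ℂ) w‖ = 1 := (RCLike.norm_conj w).trans hn
  have h1 : ‖(r : ℂ) * w‖ < 1 := by rw [norm_mul, hn, mul_one]; simpa using hr
  have h2 : ‖(r : ℂ) * (starRingEnd ℂ) w‖ < 1 := by rw [norm_mul, hn', mul_one]; simpa using hr
  have h := hasSum_mixedCoeff c h1 h2
  have h0 : ∀ m, mixedCoeff c (r * w) (r * (starRingEnd ℂ) w) m
      = ((r ^ m * gegenbauer c t m : ℝ) : ℂ) := by
    intro m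
    rw [mixedCoeff_mul_pow, mixedCoeff_eq_gegenbauer c t (mul_conj_of_norm_eq_one hn)
      (add_conj_eq_two_mul hw)]
    push_cast
    rfl
  rw [funext h0] at h
  set z : ℂ := 1 - r * w with hz
  have hzc : 1 - (r : ℂ) * (starRingEnd ℂ) w = (starRingEnd ℂ) z := by
    rw [hz, map_sub, map_mul, map_one, Complex.conj_ofReal]
  have hre : 0 < z.re := by
    have h3 := (Complex.re_le_norm ((r : ℂ) * w)).trans_lt h1
    rw [hz, Complex.sub_re, Complex.one_re]
    linarith
  -- `1 - r w` lies in the right half-plane, off the branch cut, so conjugation commutes with the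
  -- complex power and the two factors multiply to `|1 - r w|^(-2c)`.
  have harg : z.arg ≠ Real.pi := by
    intro h4
    have := (Complex.arg_eq_pi_iff.1 h4).1
    linarith
  have hprod : z ^ (-c : ℂ) * (1 - (r : ℂ) * (starRingEnd ℂ) w) ^ (-c : ℂ)
      = (((1 - 2 * r * t + r ^ 2) ^ (-c) : ℝ) : ℂ) := by
    have h5 : (starRingEnd ℂ) (-c : ℂ) = -c := by rw [map_neg, Complex.conj_ofReal]
    have h6 := Complex.conj_cpow z (-c : ℂ) harg
    rw [h5] at h6
    rw [hzc, h6, Complex.mul_conj, Complex.normSq_eq_norm_sq, ← Complex.ofReal_neg,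
      Complex.norm_cpow_real]
    congr 1
    rw [← Real.rpow_natCast, ← Real.rpow_mul (norm_nonneg _), mul_comm,
      Real.rpow_mul (norm_nonneg _), Real.rpow_natCast, ← Complex.normSq_eq_norm_sq]
    congr 1
    have h7 : w.re * w.re + w.im * w.im = 1 := by
      rw [← Complex.normSq_apply, Complex.normSq_eq_norm_sq, hn, one_pow]
    rw [hz, Complex.normSq_apply]
    simp only [Complex.sub_re, Complex.one_re, Complex.mul_re, Complex.ofReal_re, Complex.ofReal_im,
      Complex.sub_im, Complex.one_im, Complex.mul_im]
    rw [← hw]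
    linear_combination r ^ 2 * h7
  rw [hprod] at h
  exact_mod_cast h

/-! ### The expansion of the fundamental solution -/

/-- The quotient `∑ τ_j x_j z_j / (‖x‖ ‖z‖)`. -/
def tauCos {k : ℕ} (x z : E k) (τ : Fin (k + 1) → ℝ) : ℝ :=
  (∑ j, τ j * x j * z j) / (‖x‖ * ‖z‖)

theorem abs_sum_tau_le {k : ℕ} (x z : E k) {τ : Fin (k + 1) → ℝ} (hτ : ∀ j, |τ j| ≤ 1) :
    |∑ j, τ j * x j * z j| ≤ ‖x‖ * ‖z‖ := by
  refine abs_le_of_sq_le_sq ?_ (by positivity)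
  refine (Finset.sum_mul_sq_le_sq_mul_sq Finset.univ (fun j => τ j * x j) fun j => z j).trans ?_
  rw [mul_pow, EuclideanSpace.norm_sq_eq, EuclideanSpace.norm_sq_eq]
  simp only [Real.norm_eq_abs, sq_abs]
  refine mul_le_mul_of_nonneg_right (Finset.sum_le_sum fun j _ => ?_)
    (Finset.sum_nonneg fun j _ => sq_nonneg _)
  rw [mul_pow]
  exact mul_le_of_le_one_left (sq_nonneg _) ((sq_le_one_iff_abs_le_one _).2 (hτ j))

theorem abs_tauCos_le {k : ℕ} (x z : E k) {τ : Fin (k + 1) → ℝ} (hτ : ∀ j, |τ j| ≤ 1) :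
    |tauCos x z τ| ≤ 1 := by
  rw [tauCos, abs_div, abs_of_nonneg (by positivity : 0 ≤ ‖x‖ * ‖z‖)]
  exact div_le_one_of_le₀ (abs_sum_tau_le x z hτ) (by positivity)

theorem mul_tauCos {k : ℕ} (x z : E k) (τ : Fin (k + 1) → ℝ) :
    ‖x‖ * ‖z‖ * tauCos x z τ = ∑ j, τ j * x j * z j := by
  rcases eq_or_ne x 0 with rfl | hx
  · simp
  rcases eq_or_ne z 0 with rfl | hz
  · simp
  exact mul_div_cancel₀ _ (mul_ne_zero (norm_ne_zero_iff.2 hx) (norm_ne_zero_iff.2 hz))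

theorem continuous_tauCos {k : ℕ} (x z : E k) : Continuous (tauCos x z) := by
  unfold tauCos
  fun_prop

theorem continuous_gegenbauer (c : ℝ) (m : ℕ) : Continuous fun t => gegenbauer c t m := by
  unfold gegenbauer
  refine continuous_finsetSum _ fun l _ => ?_
  unfold gegenbauerTerm
  split_ifs
  · fun_prop
  · fun_prop

/-- Writing `V` as a `τ`-integral replaces `⟨x, z⟩` by `‖x‖ ‖z‖ tauCos x z τ`, and the powers of the
norms combine to degree `m` in every term. -/
theorem evalAt_zonalPoly {k : ℕ} {α : Fin (k + 1) → ℝ} (hα : ∀ j, 0 ≤ α j) (m : ℕ) (x z : E k) :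
    (zonalPoly α m x).evalAt z
      = (‖x‖ * ‖z‖) ^ m * ∫ τ, gegenbauer (mu α) (tauCos x z τ) m ∂tauProd α := by
  have hterm : ∀ l, Integrable (fun τ => (‖x‖ * ‖z‖) ^ m * gegenbauerTerm (mu α) (tauCos x z τ) m l)
        (tauProd α) ∧
      ∫ τ, (‖x‖ * ‖z‖) ^ m * gegenbauerTerm (mu α) (tauCos x z τ) m l ∂tauProd α
        = (zonalTerm α m x l).evalAt z := by
    intro l
    by_cases hl : 2 * l ≤ m
    · have h1 : ∀ τ : Fin (k + 1) → ℝ,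
          (‖x‖ * ‖z‖) ^ m * gegenbauerTerm (mu α) (tauCos x z τ) m l
          = (gegenbauerCoeff (mu α) (m - 2 * l) l * (‖x‖ * ‖z‖) ^ (2 * l))
            * MvPolynomial.eval (fun j => τ j * z j) (linearForm x ^ (m - 2 * l)) := by
        intro τ
        have h2 : MvPolynomial.eval (fun j => τ j * z j) (linearForm x)
            = ‖x‖ * ‖z‖ * tauCos x z τ := by
          rw [mul_tauCos, linearForm, map_sum]
          refine Finset.sum_congr rfl fun j _ => ?_
          rw [MvPolynomial.smul_eval, MvPolynomial.eval_X]
          ring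
        rw [map_pow, h2, gegenbauerTerm, if_pos hl, mul_pow _ (tauCos x z τ)]
        nth_rewrite 1 [← Nat.add_sub_cancel' hl]
        rw [pow_add]
        ring
      have h3 := integral_evalAt_tauProd hα (linearForm x ^ (m - 2 * l)) z
      simp_rw [h1]
      refine ⟨h3.1.const_mul _, ?_⟩
      have hN := evalAt_normSqPoly z
      rw [integral_const_mul, h3.2, zonalTerm, if_pos hl]
      unfold Poly.evalAt at hN ⊢
      rw [MvPolynomial.smul_eval, map_mul, map_pow _ (normSqPoly k), hN]
      ring
    · simp [gegenbauerTerm, zonalTerm, hl, Poly.evalAt]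
  rw [← integral_const_mul]
  simp only [gegenbauer, Finset.mul_sum]
  rw [integral_finsetSum _ fun l _ => (hterm l).1]
  simp only [fun l => (hterm l).2]
  simp [zonalPoly, Poly.evalAt]

theorem hKernel_smul_left {k : ℕ} (α : Fin (k + 1) → ℝ) (m : ℕ) (r : ℝ) (x y : E k) :
    hKernel α m (r • x) y = r ^ m * hKernel α m x y := by
  simp only [hKernel, Finset.mul_sum]
  refine Finset.sum_congr rfl fun i _ => Finset.sum_congr rfl fun j _ => ?_
  have hi : (hBasis α m i : Poly k).IsHomogeneous m := (hBasis α m i).2.1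
  rw [evalAt_smul hi]
  ring

theorem hKernel_smul_right {k : ℕ} (α : Fin (k + 1) → ℝ) (m : ℕ) (r : ℝ) (x y : E k) :
    hKernel α m x (r • y) = r ^ m * hKernel α m x y := by
  simp only [hKernel, Finset.mul_sum]
  refine Finset.sum_congr rfl fun i _ => Finset.sum_congr rfl fun j _ => ?_
  have hj : (hBasis α m j : Poly k).IsHomogeneous m := (hBasis α m j).2.1
  rw [evalAt_smul hj]
  ring

theorem norm_smul_inv_norm_smul {k : ℕ} (x : E k) : ‖x‖ • (‖x‖⁻¹ • x) = x := by
  rcases eq_or_ne x 0 with rfl | hx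
  · simp
  · exact smul_inv_smul₀ (norm_ne_zero_iff.2 hx) x

/-- The constant in front of the integral in the fundamental solution. -/
def phiConst {k : ℕ} (α : Fin (k + 1) → ℝ) : ℝ :=
  Real.Gamma (mu α) / (4 * ∏ j, Real.Gamma (α j + 1 / 2))

theorem prod_Gamma_pos {k : ℕ} {α : Fin (k + 1) → ℝ} (hα : ∀ j, 0 ≤ α j) :
    0 < ∏ j, Real.Gamma (α j + 1 / 2) :=
  Finset.prod_pos fun j _ => Real.Gamma_pos_of_pos (by linarith [hα j])

theorem phiConst_pos {k : ℕ} {α : Fin (k + 1) → ℝ} (hα : ∀ j, 0 ≤ α j) (hμ : 0 < mu α) :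
    0 < phiConst α :=
  div_pos (Real.Gamma_pos_of_pos hμ) (mul_pos (by norm_num) (prod_Gamma_pos hα))

theorem norm_rpow_mul_seriesTerm {k : ℕ} {α : Fin (k + 1) → ℝ} (hα : ∀ j, 0 ≤ α j)
    (hμ : 0 < mu α) (x : E k) {z : E k} (hz : z ≠ 0) (m : ℕ) :
    ‖z‖ ^ (2 * mu α) * seriesTerm α x z m
      = phiConst α * ∫ τ, (‖x‖ / ‖z‖) ^ m * gegenbauer (mu α) (tauCos x z τ) m ∂tauProd α := by
  have hzn : 0 < ‖z‖ := norm_pos_iff.2 hz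
  have hx := hKernel_smul_left α m ‖x‖ (‖x‖⁻¹ • x) (‖z‖⁻¹ • z)
  rw [norm_smul_inv_norm_smul] at hx
  have hz2 := hKernel_smul_right α m ‖z‖ x (‖z‖⁻¹ • z)
  rw [norm_smul_inv_norm_smul] at hz2
  have hk := hKernel_eq_zonalPoly hα hμ m x z
  rw [evalAt_zonalPoly hα, hz2, hx] at hk
  have hG := (prod_Gamma_pos hα).ne'
  have hm : mu α + m ≠ 0 := by positivity
  have hpow : ‖z‖ ^ (2 * mu α) * ‖z‖ ^ (-2 * mu α - m) = (‖z‖ ^ m)⁻¹ := by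
    rw [← Real.rpow_add hzn, show 2 * mu α + (-2 * mu α - m) = -(m : ℝ) by ring,
      Real.rpow_neg hzn.le, Real.rpow_natCast]
  rw [integral_const_mul, seriesTerm, phiConst, div_pow]
  generalize (∫ τ, gegenbauer (mu α) (tauCos x z τ) m ∂tauProd α) = J at hk ⊢
  generalize hKernel α m (‖x‖⁻¹ • x) (‖z‖⁻¹ • z) = H at hk ⊢
  generalize (∏ j, Real.Gamma (α j + 1 / 2)) = G at hk hG ⊢
  have hzm : ‖z‖ ^ m ≠ 0 := pow_ne_zero _ hzn.ne'
  calc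
    _ = 1 / (2 * (mu α + m)) * ‖x‖ ^ m * (‖z‖ ^ (2 * mu α) * ‖z‖ ^ (-2 * mu α - m)) * H := by ring
    _ = _ := by
      rw [hpow]
      rw [mul_pow] at hk
      -- Only `‖z‖ ^ m` is cancelled. Keeping `‖x‖ ^ m` on both sides covers `x = 0`.
      have hk' : 2 * G * (‖x‖ ^ m * H) = (m + mu α) * Real.Gamma (mu α) * (‖x‖ ^ m * J) := by
        apply mul_left_cancel₀ hzm
        linear_combination hk
      field_simp
      linear_combination 2 * hk'

theorem rpow_mul_Phi {k : ℕ} (α : Fin (k + 1) → ℝ) (x : E k) {z : E k} (hz : z ≠ 0) :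
    ‖z‖ ^ (2 * mu α) * Phi α x z
      = phiConst α * ∫ τ, (1 - 2 * (‖x‖ / ‖z‖) * tauCos x z τ + (‖x‖ / ‖z‖) ^ 2) ^ (-mu α)
        ∂tauProd α := by
  have hzn : 0 < ‖z‖ := norm_pos_iff.2 hz
  rw [Phi, mul_left_comm, ← integral_const_mul]
  congr 1
  refine integral_congr_ae ?_
  filter_upwards [ae_tauProd_abs_le α] with τ hτ
  have ht := abs_le.1 (abs_tauCos_le x z hτ)
  have hr : 0 ≤ ‖x‖ / ‖z‖ := by positivity
  -- From `tauCos ≤ 1` the expression is at least `(1 - ‖x‖ / ‖z‖)²`.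
  have hnn : 0 ≤ 1 - 2 * (‖x‖ / ‖z‖) * tauCos x z τ + (‖x‖ / ‖z‖) ^ 2 := by
    nlinarith [sq_nonneg (1 - ‖x‖ / ‖z‖), mul_le_mul_of_nonneg_left ht.2 hr]
  have hPsi : Psi x z τ
      = ‖z‖ ^ 2 * (1 - 2 * (‖x‖ / ‖z‖) * tauCos x z τ + (‖x‖ / ‖z‖) ^ 2) := by
    rw [Psi, ← mul_tauCos]
    field_simp
    ring
  rw [hPsi, Real.mul_rpow (sq_nonneg _) hnn, ← mul_assoc, ← Real.rpow_natCast, ← Real.rpow_mul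
    hzn.le, ← Real.rpow_add hzn]
  norm_num

theorem hasSum_rpow_mul_seriesTerm {k : ℕ} {α : Fin (k + 1) → ℝ} (hα : ∀ j, 0 ≤ α j)
    (hμ : 0 < mu α) {x z : E k} (hxz : ‖x‖ < ‖z‖) :
    HasSum (fun m => ‖z‖ ^ (2 * mu α) * seriesTerm α x z m) (‖z‖ ^ (2 * mu α) * Phi α x z) := by
  have hzn : 0 < ‖z‖ := (norm_nonneg x).trans_lt hxz
  have hz : z ≠ 0 := norm_pos_iff.1 hzn
  have hprob := fun j => tauMeasure_isProbabilityMeasure (hα j)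
  have hr : |‖x‖ / ‖z‖| < 1 := by
    rw [abs_of_nonneg (by positivity)]
    exact (div_lt_one hzn).2 hxz
  simp_rw [norm_rpow_mul_seriesTerm hα hμ x hz]
  rw [rpow_mul_Phi α x hz]
  refine HasSum.mul_left _ ?_
  refine hasSum_integral_of_dominated_convergence
    (fun m _ => gegenbauerBound (mu α) m * (‖x‖ / ‖z‖) ^ m) (fun m => ?_) (fun m => ?_)
    (ae_of_all _ fun _ => summable_gegenbauerBound (mu α) hr) (integrable_const _) ?_
  · exact (((continuous_gegenbauer (mu α) m).comp (continuous_tauCos x z)).const_mul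
      _).aestronglyMeasurable
  · filter_upwards [ae_tauProd_abs_le α] with τ hτ
    rw [norm_mul, Real.norm_of_nonneg (by positivity : 0 ≤ (‖x‖ / ‖z‖) ^ m), mul_comm]
    exact mul_le_mul_of_nonneg_right (abs_gegenbauer_le hμ (abs_tauCos_le x z hτ) m) (by positivity)
  · filter_upwards [ae_tauProd_abs_le α] with τ hτ
    exact hasSum_gegenbauer (mu α) (abs_tauCos_le x z hτ) hr

theorem abs_rpow_mul_seriesTerm_le {k : ℕ} {α : Fin (k + 1) → ℝ} (hα : ∀ j, 0 ≤ α j)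
    (hμ : 0 < mu α) (x : E k) {z : E k} (hz : z ≠ 0) (m : ℕ) :
    |‖z‖ ^ (2 * mu α) * seriesTerm α x z m|
      ≤ phiConst α * (gegenbauerBound (mu α) m * (‖x‖ / ‖z‖) ^ m) := by
  have hprob := fun j => tauMeasure_isProbabilityMeasure (hα j)
  rw [norm_rpow_mul_seriesTerm hα hμ x hz, abs_mul, abs_of_pos (phiConst_pos hα hμ)]
  refine mul_le_mul_of_nonneg_left ?_ (phiConst_pos hα hμ).le
  have h := norm_integral_le_of_norm_le_const (μ := tauProd α)
    (f := fun τ => (‖x‖ / ‖z‖) ^ m * gegenbauer (mu α) (tauCos x z τ) m)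
    (C := gegenbauerBound (mu α) m * (‖x‖ / ‖z‖) ^ m) ?_
  · simpa using h
  · filter_upwards [ae_tauProd_abs_le α] with τ hτ
    rw [norm_mul, Real.norm_of_nonneg (by positivity : 0 ≤ (‖x‖ / ‖z‖) ^ m), mul_comm]
    exact mul_le_mul_of_nonneg_right (abs_gegenbauer_le hμ (abs_tauCos_le x z hτ) m) (by positivity)

theorem hasSum_seriesTerm {k : ℕ} {α : Fin (k + 1) → ℝ} (hα : ∀ j, 0 ≤ α j)
    (hμ : 0 < mu α) {x z : E k} (hxz : ‖x‖ < ‖z‖) :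
    HasSum (seriesTerm α x z) (Phi α x z) := by
  have hzn : 0 < ‖z‖ := (norm_nonneg x).trans_lt hxz
  exact (hasSum_mul_left_iff (Real.rpow_pos_of_pos hzn _).ne').1
    (hasSum_rpow_mul_seriesTerm hα hμ hxz)

/-! ### Uniform convergence by the Weierstrass M-test. -/

theorem abs_rpow_mul_seriesTerm_le_of_div_le {k : ℕ} {α : Fin (k + 1) → ℝ} (hα : ∀ j, 0 ≤ α j)
    (hμ : 0 < mu α) {q : ℝ} {x z : E k} (hz : z ≠ 0) (hq : ‖x‖ / ‖z‖ ≤ q) (m : ℕ) :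
    |‖z‖ ^ (2 * mu α) * seriesTerm α x z m|
      ≤ phiConst α * (gegenbauerBound (mu α) m * (max q 0) ^ m) := by
  refine (abs_rpow_mul_seriesTerm_le hα hμ x hz m).trans ?_
  refine mul_le_mul_of_nonneg_left ?_ (phiConst_pos hα hμ).le
  refine mul_le_mul_of_nonneg_left ?_ (gegenbauerBound_nonneg hμ m)
  exact pow_le_pow_left₀ (by positivity) (hq.trans (le_max_left _ _)) m

-- Since `q` may be very negative, `max q 0` keeps the majorant summable.
theorem summable_phiConst_mul {k : ℕ} (α : Fin (k + 1) → ℝ) {q : ℝ} (hq : q < 1) :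
    Summable fun m => phiConst α * (gegenbauerBound (mu α) m * (max q 0) ^ m) := by
  refine (summable_gegenbauerBound (mu α) ?_).mul_left _
  rw [abs_of_nonneg (le_max_right _ _)]
  exact max_lt hq one_pos

theorem norm_lt_of_div_le {k : ℕ} {q : ℝ} (hq : q < 1) {x z : E k} (hz : z ≠ 0)
    (h : ‖x‖ / ‖z‖ ≤ q) : ‖x‖ < ‖z‖ :=
  (div_lt_one (norm_pos_iff.2 hz)).1 (h.trans_lt hq)

theorem tendstoUniformlyOn_seriesTerm {k : ℕ} {α : Fin (k + 1) → ℝ} (hα : ∀ j, 0 ≤ α j)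
    (hμ : 0 < mu α) {q r : ℝ} (hq : q < 1) (hr : 0 < r) :
    TendstoUniformlyOn
      (fun (N : ℕ) (p : E k × E k) => ∑ m ∈ Finset.range N, seriesTerm α p.1 p.2 m)
      (fun p => Phi α p.1 p.2) atTop {p | r ≤ ‖p.2‖ ∧ ‖p.1‖ / ‖p.2‖ ≤ q} := by
  have hne : ∀ p : E k × E k, r ≤ ‖p.2‖ → p.2 ≠ 0 := fun p hp =>
    norm_pos_iff.1 (hr.trans_le hp)
  have h := tendstoUniformlyOn_tsum_nat (f := fun m (p : E k × E k) => seriesTerm α p.1 p.2 m)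
    ((summable_phiConst_mul α hq).mul_left (r ^ (2 * mu α))⁻¹)
    (s := {p | r ≤ ‖p.2‖ ∧ ‖p.1‖ / ‖p.2‖ ≤ q}) ?_
  · refine h.congr_right fun p hp => ?_
    exact (hasSum_seriesTerm hα hμ (norm_lt_of_div_le hq (hne p hp.1) hp.2)).tsum_eq
  · intro m p hp
    have hz := hne p hp.1
    have hpos : 0 < r ^ (2 * mu α) := Real.rpow_pos_of_pos hr _
    have h1 := abs_rpow_mul_seriesTerm_le_of_div_le hα hμ hz hp.2 m
    rw [abs_mul, abs_of_nonneg (by positivity)] at h1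
    -- As `μ > 0`, the lower bound on `‖z‖` makes `r^(-2μ)` an upper bound for `‖z‖^(-2μ)`.
    have h2 : r ^ (2 * mu α) ≤ ‖p.2‖ ^ (2 * mu α) :=
      Real.rpow_le_rpow hr.le hp.1 (by positivity)
    rw [Real.norm_eq_abs, le_inv_mul_iff₀ hpos]
    exact (mul_le_mul_of_nonneg_right h2 (abs_nonneg _)).trans h1

theorem tendstoUniformlyOn_rpow_mul_seriesTerm {k : ℕ} {α : Fin (k + 1) → ℝ} (hα : ∀ j, 0 ≤ α j)
    (hμ : 0 < mu α) {q : ℝ} (hq : q < 1) :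
    TendstoUniformlyOn
      (fun (N : ℕ) (p : E k × E k) =>
        ‖p.2‖ ^ (2 * mu α) * ∑ m ∈ Finset.range N, seriesTerm α p.1 p.2 m)
      (fun p => ‖p.2‖ ^ (2 * mu α) * Phi α p.1 p.2) atTop {p | p.2 ≠ 0 ∧ ‖p.1‖ / ‖p.2‖ ≤ q} := by
  simp_rw [Finset.mul_sum]
  have h := tendstoUniformlyOn_tsum_nat
    (f := fun m (p : E k × E k) => ‖p.2‖ ^ (2 * mu α) * seriesTerm α p.1 p.2 m)
    (summable_phiConst_mul α hq) (s := {p | p.2 ≠ 0 ∧ ‖p.1‖ / ‖p.2‖ ≤ q})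
    fun m p hp => abs_rpow_mul_seriesTerm_le_of_div_le hα hμ hp.1 hp.2 m
  refine h.congr_right fun p hp => ?_
  exact (hasSum_rpow_mul_seriesTerm hα hμ (norm_lt_of_div_le hq hp.1 hp.2)).tsum_eq

end Dunkl

end

theorem theorem2p2 (k : ℕ) (α : Fin (k + 1) → ℝ) (hα : ∀ j, 0 ≤ α j) (hμ : 0 < Dunkl.mu α) :
    (∀ x z : Dunkl.E k, ‖x‖ < ‖z‖ → HasSum (Dunkl.seriesTerm α x z) (Dunkl.Phi α x z)) ∧
    (∀ q : ℝ, q < 1 → ∀ r : ℝ, 0 < r →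
      TendstoUniformlyOn
        (fun (N : ℕ) (p : Dunkl.E k × Dunkl.E k) => ∑ m ∈ Finset.range N, Dunkl.seriesTerm α p.1 p.2 m)
        (fun p => Dunkl.Phi α p.1 p.2) atTop
        {p | r ≤ ‖p.2‖ ∧ ‖p.1‖ / ‖p.2‖ ≤ q}) ∧
    (∀ q : ℝ, q < 1 →
      TendstoUniformlyOn
        (fun (N : ℕ) (p : Dunkl.E k × Dunkl.E k) =>
          ‖p.2‖ ^ (2 * Dunkl.mu α) * ∑ m ∈ Finset.range N, Dunkl.seriesTerm α p.1 p.2 m)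
        (fun p => ‖p.2‖ ^ (2 * Dunkl.mu α) * Dunkl.Phi α p.1 p.2) atTop
        {p | p.2 ≠ 0 ∧ ‖p.1‖ / ‖p.2‖ ≤ q}) := by
  -- `HasSum` is unconditional convergence, which for real series is absolute convergence.
  exact ⟨fun _ _ h => Dunkl.hasSum_seriesTerm hα hμ h,
    fun _ hq _ hr => Dunkl.tendstoUniformlyOn_seriesTerm hα hμ hq hr,
    fun _ hq => Dunkl.tendstoUniformlyOn_rpow_mul_seriesTerm hα hμ hq⟩
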